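/- Let $(\Omega,\mathcal F)$ be a measurable space with a jointly measurable flow $\{\theta_s\}_{s\in\mathbb R}$ ($\theta_0=\mathrm{id}$, $\theta_{s+t}=\theta_s\circ\theta_t$) and random points $\cdots<t_{-1}<t_0\le 0<t_1<t_2<\cdots$ on $\mathbb R$ with $t_n\to\pm\infty$ as $n\to\pm\infty$, such that $N(B)=\#\{n\in\mathbb Z: t_n\in B\}$ satisfies $N(B)\circ\theta_s=N(B+s)$ for all $s\in\mathbb R$ and bounded Borel sets $B$. Put $T_n=t_n-t_{n-1}$ for $n\in\mathbb Z$, $N(t)=N([0,t])$ for $t\ge0$, $T_n^{(v)}=\min(T_n,v)$ for $v>0$, and let $R(t)=t_n-t$ for $t_{n-1}\le t<t_n$ be the residual time to the next point. Let $\mathcal F_t=\sigma\big(\{R(u):u\le t\}\cup\{\{t_n\le t\}:n\in\mathbb Z\}\big)$ for $t\in\mathbb R$, let $\mathcal F_{0-}=\sigma\big(\bigcup_{s<0}\mathcal F_s\big)$, and for a random time $\tau$ let $\mathcal F_{\tau-}=\sigma\big(\{A\cap\{s<\tau\}: s\in\mathbb R,\ A\in\mathcal F_s\}\big)$. Let $\mathbb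 P$ (expectation $\mathbb E$) be a probability measure on $(\Omega,\mathcal F)$ which is a Palm distribution, that is, $\mathbb P(t_0=0)=1$, $\mathbb E[T_n]<\infty$ for $n\ge1$, and $\mathbb P$ is invariant under $\omega\mapsto\theta_{t_n(\omega)}(\omega)$ for every $n\in\mathbb Z$. Let $\overline{\mathbb P}$ (expectation $\overline{\mathbb E}$) be the associated stationary law $$\overline{\mathbb P}(A)=\frac{1}{\mathbb E[T_1]}\,\mathbb E\Big[\int_0^{T_1}1_A(\theta_t\omega)\,dt\Big],\qquad A\in\mathcal F,$$ and define $$\widetilde\lambda^{(v)}(t)=\frac{1}{\mathbb E\big[T_n^{(v)}\mid\mathcal F_{t_{n-1}-}\big]},\qquad t_{n-1}\le t<t_n .$$ Assume that (i) $\{T_n;n\in\mathbb Z\}$ is a stationary and ergodic sequence under $\mathbb P$; (ii) for some $v>0$, the family $\{\widetilde\lambda^{(v)}(t):t\ge0\}$ is uniformly integrable under $\mathbb P$; (iii) for all $A\in\mathcal F$ and $u\ge0$, $$\lim_{t\to\infty}\overline{\mathbb P}\big(\{\omega:\theta_t\omega\in A\}\cap\{t_1\le u\}\big)=\overline{\mathbb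 P}(A)\,\overline{\mathbb P}(t_1\le u).$$ Then $\mathbb E[N(t)]<\infty$ for all $t\ge0$, and there is $\lambda>0$ such that $$\lim_{t\to\infty}\frac{\mathbb E[N(t)]}{t}=\lambda\qquad\text{and}\qquad \lim_{t\to\infty}\big(\mathbb E[N(t+h)]-\mathbb E[N(t)]\big)=\lambda h\quad\text{for every } h>0 .$$ Moreover, for every $v>0$, $$\lambda=\frac1{\mathbb E[T_1]}=\overline{\mathbb E}\left[\frac{1\big(R(0)\le v\big)}{g_v}\right],\qquad g_v(\omega)=\mathbb E\big[T_1^{(v)}\mid\mathcal F_{0-}\big]\big(\theta_{t_0(\omega)}(\omega)\big),$$ where the random variable under $\overline{\mathbb E}$ is integrable; $g_v$ is the conditional mean under $\mathbb P$, evaluated after moving the origin to the last point $t_0(\omega)\le 0$. -/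

import Mathlib

open MeasureTheory Filter Topology
open scoped NNReal ENNReal

/-- A simple point process on the real line, with infinitely many points on both sides of the
origin, carried by a measurable space with a measurable flow `θ`. The points are
`⋯ < pt (-1) < pt 0 ≤ 0 < pt 1 < pt 2 < ⋯`; the flow moves the origin, that is, the point process
seen from `θ s ω` is the one of `ω` with origin placed at `s`. -/
structure FlowPointProcess (Ω : Type*) [MeasurableSpace Ω] where
  /-- the shift operators -/
  θ : ℝ → Ω → Ω
  measurable_θ : Measurable (fun p : ℝ × Ω => θ p.1 p.2)
  θ_zero : ∀ ω, θ 0 ω = ω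
  θ_add : ∀ s t ω, θ (s + t) ω = θ s (θ t ω)
  /-- the points (counting times) `t_n`, `n ∈ ℤ` -/
  pt : ℤ → Ω → ℝ
  measurable_pt : ∀ n, Measurable (pt n)
  pt_strictMono : ∀ ω, StrictMono (fun n => pt n ω)
  pt_atTop : ∀ ω, Tendsto (fun n => pt n ω) atTop atTop
  pt_atBot : ∀ ω, Tendsto (fun n => pt n ω) atBot atBot
  pt_zero_nonpos : ∀ ω, pt 0 ω ≤ 0
  pt_one_pos : ∀ ω, 0 < pt 1 ω
  /-- consistency `N(B) ∘ θ_s = N(B + s)` for bounded Borel sets `B` -/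
  count_θ : ∀ (s : ℝ) (ω : Ω) (B : Set ℝ), MeasurableSet B → Bornology.IsBounded B →
    Set.ncard {n : ℤ | pt n (θ s ω) ∈ B} = Set.ncard {n : ℤ | pt n ω ∈ (fun x => x + s) '' B}

namespace FlowPointProcess

variable {Ω : Type*} [MeasurableSpace Ω] (X : FlowPointProcess Ω)

/-- `N(B)`, the number of points in `B` (meant for bounded `B`). -/
noncomputable def count (B : Set ℝ) (ω : Ω) : ℕ := Set.ncard {n : ℤ | X.pt n ω ∈ B}

/-- The counting process `N(t) = N([0, t])`. -/
noncomputable def N (t : ℝ) (ω : Ω) : ℕ := X.count (Set.Icc 0 t) ω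

/-- The interarrival times `T_n = t_n - t_{n-1}`. -/
def T (n : ℤ) (ω : Ω) : ℝ := X.pt n ω - X.pt (n - 1) ω

/-- The truncated interarrival times `T_n^{(v)} = min (T_n, v)`. -/
noncomputable def Ttrunc (v : ℝ) (n : ℤ) (ω : Ω) : ℝ := min (X.T n ω) v

/-- The index `n` of the next point after `t`, i.e. the `n` with `t_{n-1} ≤ t < t_n`
(it equals `N(t)` when `t_0 = 0 ≤ t`). -/
noncomputable def nextIdx (t : ℝ) (ω : Ω) : ℤ := sSup {n : ℤ | X.pt n ω ≤ t} + 1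

/-- The residual time `R(t)` to the next point after `t`. -/
noncomputable def R (t : ℝ) (ω : Ω) : ℝ := X.pt (X.nextIdx t ω) ω - t

/-- The σ-algebra `F_t` generated by the `R(u)`, `u ≤ t`, and the events `{t_n ≤ t}`, `n ∈ ℤ`. -/
@[reducible] noncomputable def F (t : ℝ) : MeasurableSpace Ω :=
  (⨆ (u : ℝ) (_ : u ≤ t), MeasurableSpace.comap (X.R u) inferInstance) ⊔
    MeasurableSpace.generateFrom {A | ∃ n : ℤ, A = {ω | X.pt n ω ≤ t}}

/-- The left limit `F_{t-} = σ(⋃_{s < t} F_s)`. -/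
@[reducible] noncomputable def Fleft (t : ℝ) : MeasurableSpace Ω := ⨆ (s : ℝ) (_ : s < t), X.F s

/-- For a random time `τ`, the σ-algebra `F_{τ-}` generated by the sets `A ∩ {s < τ}`, where
`s ∈ ℝ` and `A ∈ F_s`. -/
@[reducible] noncomputable def Fpre (τ : Ω → ℝ) : MeasurableSpace Ω :=
  MeasurableSpace.generateFrom
    {C | ∃ (s : ℝ) (A : Set Ω), MeasurableSet[X.F s] A ∧ C = A ∩ {ω | s < τ ω}}

/-- The process `1 / E[T_n^{(v)} | F_{t_{n-1}-}]` for `t_{n-1} ≤ t < t_n`,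
the conditional expectation being with respect to `P`. -/
noncomputable def tildeLam (P : Measure Ω) (v t : ℝ) (ω : Ω) : ℝ :=
  1 / (P[X.Ttrunc v (X.nextIdx t ω) | X.Fpre (X.pt (X.nextIdx t ω - 1))]) ω

/-- The conditional mean `E[T_1^{(v)} | F_{0-}]` under `P`, transported along the flow: at a sample
point `ω` it is evaluated after the origin is moved to the last point `t_0(ω) ≤ 0`. When
`t_0(ω) = 0` no move takes place. -/
noncomputable def condMean (P : Measure Ω) (v : ℝ) (ω : Ω) : ℝ :=
  (P[X.Ttrunc v 1 | X.Fleft 0]) (X.θ (X.pt 0 ω) ω)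

/-- The measure `A ↦ (1 / E[T_1]) E[∫_0^{T_1} 1_A(θ_t ω) dt]`, with `E` the expectation
under `P`; see `stat_apply`. -/
noncomputable def stat (P : Measure Ω) : Measure Ω :=
  ENNReal.ofReal (1 / ∫ ω, X.T 1 ω ∂P) •
    Measure.map (fun p : Ω × ℝ => X.θ p.2 p.1)
      ((P.prod volume).restrict {p : Ω × ℝ | 0 ≤ p.2 ∧ p.2 < X.T 1 p.1})

theorem stat_apply (P : Measure Ω) [IsProbabilityMeasure P] {A : Set Ω} (hA : MeasurableSet A) :
    X.stat P A = ENNReal.ofReal (1 / ∫ ω, X.T 1 ω ∂P) *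
      ∫⁻ ω, (∫⁻ t in Set.Ico 0 (X.T 1 ω), A.indicator 1 (X.θ t ω)) ∂P := by
  have hm : Measurable (fun p : Ω × ℝ => X.θ p.2 p.1) := X.measurable_θ.comp measurable_swap
  have hT : Measurable (X.T 1) := (X.measurable_pt 1).sub (X.measurable_pt _)
  have hS : MeasurableSet {p : Ω × ℝ | 0 ≤ p.2 ∧ p.2 < X.T 1 p.1} :=
    (measurableSet_le measurable_const measurable_snd).inter
      (measurableSet_lt measurable_snd (hT.comp measurable_fst))
  rw [stat, Measure.smul_apply, smul_eq_mul, Measure.map_apply hm hA,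
    Measure.restrict_apply (hm hA), Measure.prod_apply ((hm hA).inter hS)]
  congr 1
  refine lintegral_congr fun ω => ?_
  have hω : Measurable (fun t => X.θ t ω) := hm.comp measurable_prodMk_left
  have h1 : (fun t => A.indicator (1 : Ω → ℝ≥0∞) (X.θ t ω))
      = ((fun t => X.θ t ω) ⁻¹' A).indicator 1 := by
    funext t
    rfl
  rw [h1, lintegral_indicator_one (hω hA), Measure.restrict_apply (hω hA)]
  rfl

end FlowPointProcess

/-! The proof passes from Palm to stationary quantities by Campbell's formula
(`lintegral_stat_tsum_pt`): the stationary mean of the sum of `f` seen from the points in `(0, u]`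
is `λ u` times the Palm mean of `f`, where `λ = 1 / E[T_1]`.

Take for `f` the indicator that the `k`-th point after `t` lies within `h`. For small `u` there is
essentially at most one point in `(0, u]`, so `λ u` times the Palm probability is close to the
stationary probability of the same event, seen from `t`, intersected with `{t_1 ≤ u}`. Mixing
factorizes the latter as `t → ∞`. Since the stationary probability of `t_1 ≤ u` is `λ E[min(T_1, u)]
~ λ u`, each Palm probability converges to its stationary counterpart (`tendsto_palm_pt_θ_le`).

The mean number of points in `(t, t + h]` is the sum over `k ≥ 1` of these probabilities, and the
stationary sum is `λ h`. Exchanging limit and sum needs tails that are small uniformly in `t`. For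
this, a point `t_n` is spread over `[t_n, t_n + T_{n+1}^{(v)})` with density `1 / E[T_{n+1}^{(v)} |
F_{t_n-}]`, which has conditional mass one. Tail sums are thereby bounded by integrals of `tildeLam`
over an event of small probability (`tsum_palm_le_lintegral_tildeLam`, `exists_tsum_palm_tail_le`).

Linear growth follows by Cesàro averaging. The formula for `λ` comes from integrating over one
cycle, where `R(0) ≤ v` holds on a set of length `T_1^{(v)}`. -/

namespace FlowPointProcess

variable {Ω : Type*} [MeasurableSpace Ω] (X : FlowPointProcess Ω)

/-! ### Numbering of the points, the flow, and measurability. -/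

/-- The points run to `±∞`, so the supremum defining `nextIdx` is over a nonempty set bounded above
and is attained. Comparisons of points with times thus become integer inequalities. -/
theorem pt_le_iff (n : ℤ) (t : ℝ) (ω : Ω) : X.pt n ω ≤ t ↔ n < X.nextIdx t ω := by
  have hne : {n : ℤ | X.pt n ω ≤ t}.Nonempty :=
    ((X.pt_atBot ω).eventually (eventually_le_atBot t)).exists
  have hbdd : BddAbove {n : ℤ | X.pt n ω ≤ t} := by
    obtain ⟨m, hm⟩ := ((X.pt_atTop ω).eventually (eventually_gt_atTop t)).exists
    refine ⟨m, fun n hn => ?_⟩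
    by_contra! h
    exact absurd (lt_of_lt_of_le (hm.trans (X.pt_strictMono ω h)) hn) (lt_irrefl _)
  rw [nextIdx, Int.lt_add_one_iff]
  refine ⟨fun h => le_csSup hbdd h, fun h => ?_⟩
  exact ((X.pt_strictMono ω).monotone h).trans (Int.csSup_mem hne hbdd)

theorem lt_pt_iff (n : ℤ) (t : ℝ) (ω : Ω) : t < X.pt n ω ↔ X.nextIdx t ω ≤ n := by
  rw [← not_le, pt_le_iff, not_lt]

theorem nextIdx_eq_iff (n : ℤ) (t : ℝ) (ω : Ω) :
    X.nextIdx t ω = n ↔ X.pt (n - 1) ω ≤ t ∧ t < X.pt n ω := by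
  rw [pt_le_iff, lt_pt_iff]; omega

theorem nextIdx_mono (ω : Ω) : Monotone fun t => X.nextIdx t ω := by
  intro s t hst
  rw [← X.lt_pt_iff]
  exact hst.trans_lt ((X.lt_pt_iff _ t ω).2 le_rfl)

/-- Consistency of the counts, tested on singletons, already determines the set of points after a
shift. -/
theorem exists_pt_θ_eq_iff (s x : ℝ) (ω : Ω) :
    (∃ n, X.pt n (X.θ s ω) = x) ↔ ∃ n, X.pt n ω = x + s := by
  have key : ∀ (ω : Ω) (y : ℝ), {n : ℤ | X.pt n ω = y}.ncard ≠ 0 ↔ ∃ n, X.pt n ω = y := by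
    intro ω y
    have hs : {n : ℤ | X.pt n ω = y}.Subsingleton := fun a ha b hb =>
      (X.pt_strictMono ω).injective (ha.trans hb.symm)
    rw [Ne, Set.ncard_eq_zero hs.finite, ← Ne, ← Set.nonempty_iff_ne_empty]
    rfl
  have h := X.count_θ s ω {x} (measurableSet_singleton x) Bornology.isBounded_singleton
  simp only [Set.image_singleton, Set.mem_singleton_iff] at h
  rw [← key, ← key, h]

/-- The flow moves the origin and renumbers the points accordingly. -/
theorem pt_θ (n : ℤ) (s : ℝ) (ω : Ω) :
    X.pt n (X.θ s ω) = X.pt (n + X.nextIdx s ω - 1) ω - s := by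
  -- The renumbering `σ` is an order automorphism of `ℤ`, hence a translation; its offset is fixed
  -- by `t_0 ≤ 0 < t_1` for the shifted process.
  have h1 : ∀ n, ∃ m, X.pt m ω = X.pt n (X.θ s ω) + s := fun n =>
    (X.exists_pt_θ_eq_iff s _ ω).1 ⟨n, rfl⟩
  choose σ hσ using h1
  have hmono : StrictMono σ := by
    intro a b hab
    rw [← (X.pt_strictMono ω).lt_iff_lt, hσ, hσ]
    simpa using X.pt_strictMono (X.θ s ω) hab
  have hsurj : Function.Surjective σ := by
    intro m
    obtain ⟨n, hn⟩ := (X.exists_pt_θ_eq_iff s (X.pt m ω - s) ω).2 ⟨m, by ring⟩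
    refine ⟨n, (X.pt_strictMono ω).injective ?_⟩
    simp only [hσ, hn]; ring
  have hsucc : ∀ n, σ (n + 1) = σ n + 1 := fun n => by
    simpa using (hmono.orderIsoOfSurjective σ hsurj).map_succ n
  have hshift : ∀ n, σ n = n + σ 0 := by
    intro n
    induction n with
    | zero => simp
    | succ k ih => rw [hsucc, ih]; ring
    | pred k ih =>
      have := hsucc (-(k : ℤ) - 1)
      rw [sub_add_cancel, ih] at this
      linarith
  have h0 : σ 0 = X.nextIdx s ω - 1 := by
    have h2 : σ 0 < X.nextIdx s ω := by
      rw [← X.pt_le_iff, hσ]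
      linarith [X.pt_zero_nonpos (X.θ s ω)]
    have h3 : X.nextIdx s ω ≤ σ 1 := by
      rw [← X.lt_pt_iff, hσ]
      linarith [X.pt_one_pos (X.θ s ω)]
    rw [hshift] at h3
    omega
  have := hσ n
  rw [hshift, h0] at this
  rw [show n + X.nextIdx s ω - 1 = n + (X.nextIdx s ω - 1) by ring]
  linarith

theorem nextIdx_pt (n : ℤ) (ω : Ω) : X.nextIdx (X.pt n ω) ω = n + 1 := by
  rw [nextIdx_eq_iff]
  exact ⟨by simp, X.pt_strictMono ω (lt_add_one n)⟩

theorem nextIdx_zero (ω : Ω) : X.nextIdx 0 ω = 1 := by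
  rw [nextIdx_eq_iff]
  exact ⟨by simpa using X.pt_zero_nonpos ω, X.pt_one_pos ω⟩

theorem pt_θ_pt (j n : ℤ) (ω : Ω) :
    X.pt j (X.θ (X.pt n ω) ω) = X.pt (j + n) ω - X.pt n ω := by
  rw [pt_θ, nextIdx_pt]; congr 2; ring

theorem θ_pt_θ (n : ℤ) (s : ℝ) (ω : Ω) :
    X.θ (X.pt n (X.θ s ω)) (X.θ s ω) =
      X.θ (X.pt (n + X.nextIdx s ω - 1) ω) ω := by
  rw [← X.θ_add, pt_θ, sub_add_cancel]

/-- For `k ≥ 1` this function gives the absolute position of the `k`-th point after `s`, whose index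
moves with `nextIdx`. This monotonicity drives both comparison inequalities below. -/
theorem monotone_add_pt_θ (k : ℤ) (ω : Ω) : Monotone fun s => s + X.pt k (X.θ s ω) := by
  intro s t hst
  simp only [pt_θ, add_sub_cancel]
  refine (X.pt_strictMono ω).monotone ?_
  have := X.nextIdx_mono ω hst
  simp only at this
  omega

theorem T_pos (n : ℤ) (ω : Ω) : 0 < X.T n ω :=
  sub_pos.2 (X.pt_strictMono ω (sub_one_lt n))

theorem measurable_T (n : ℤ) : Measurable (X.T n) := (X.measurable_pt n).sub (X.measurable_pt _)

theorem measurable_Ttrunc (v : ℝ) (n : ℤ) : Measurable (X.Ttrunc v n) :=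
  (X.measurable_T n).min measurable_const

theorem Ttrunc_pos {v : ℝ} (hv : 0 < v) (n : ℤ) (ω : Ω) : 0 < X.Ttrunc v n ω :=
  lt_min (X.T_pos n ω) hv

theorem integrable_Ttrunc (P : Measure Ω) [IsFiniteMeasure P] {v : ℝ} (hv : 0 < v) (n : ℤ) :
    Integrable (X.Ttrunc v n) P := by
  refine Integrable.of_bound (X.measurable_Ttrunc v n).aestronglyMeasurable v (ae_of_all _ ?_)
  intro ω
  rw [Real.norm_eq_abs, abs_of_pos (X.Ttrunc_pos hv n ω)]
  exact min_le_right _ _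

theorem measurable_nextIdx (t : ℝ) : Measurable (X.nextIdx t) := by
  refine measurable_to_countable' fun n => ?_
  have : X.nextIdx t ⁻¹' {n} = {ω | X.pt (n - 1) ω ≤ t} ∩ {ω | t < X.pt n ω} := by
    ext ω
    simp [nextIdx_eq_iff]
  rw [this]
  exact (measurableSet_le (X.measurable_pt _) measurable_const).inter
    (measurableSet_lt measurable_const (X.measurable_pt _))

theorem measurable_R (t : ℝ) : Measurable (X.R t) := by
  have h : Measurable fun p : ℤ × Ω => X.pt p.1 p.2 :=
    measurable_from_prod_countable_right X.measurable_pt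
  exact (h.comp ((X.measurable_nextIdx t).prodMk measurable_id)).sub_const t

theorem measurable_θ_left (s : ℝ) : Measurable (X.θ s) :=
  X.measurable_θ.comp measurable_prodMk_left

theorem measurable_θ_pt (n : ℤ) : Measurable fun ω => X.θ (X.pt n ω) ω :=
  X.measurable_θ.comp ((X.measurable_pt n).prodMk measurable_id)

theorem F_le (t : ℝ) : X.F t ≤ (inferInstance : MeasurableSpace Ω) := by
  refine sup_le (iSup₂_le fun u _ => (X.measurable_R u).comap_le) ?_
  refine MeasurableSpace.generateFrom_le ?_
  rintro _ ⟨n, rfl⟩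
  exact measurableSet_le (X.measurable_pt n) measurable_const

theorem Fleft_le (t : ℝ) : X.Fleft t ≤ (inferInstance : MeasurableSpace Ω) :=
  iSup₂_le fun s _ => X.F_le s

theorem Fpre_le {τ : Ω → ℝ} (hτ : Measurable τ) :
    X.Fpre τ ≤ (inferInstance : MeasurableSpace Ω) := by
  refine MeasurableSpace.generateFrom_le ?_
  rintro _ ⟨s, A, hA, rfl⟩
  exact (X.F_le s A hA).inter (measurableSet_lt measurable_const hτ)

/-- The points up to `t_n` are known strictly before `t_n`. -/
theorem measurable_pt_Fpre {k n : ℤ} (hkn : k ≤ n) : Measurable[X.Fpre (X.pt n)] (X.pt k) := by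
  refine measurable_of_Iic fun s => ?_
  have h1 : MeasurableSet[X.Fpre (X.pt n)] {ω | s < X.pt n ω} :=
    MeasurableSpace.measurableSet_generateFrom ⟨s, Set.univ, MeasurableSet.univ, by simp⟩
  have h2 : MeasurableSet[X.Fpre (X.pt n)] ({ω | X.pt k ω ≤ s} ∩ {ω | s < X.pt n ω}) := by
    refine MeasurableSpace.measurableSet_generateFrom ⟨s, _, ?_, rfl⟩
    have : MeasurableSpace.generateFrom {A | ∃ n : ℤ, A = {ω | X.pt n ω ≤ s}} ≤ X.F s :=
      le_sup_right
    exact this _ (MeasurableSpace.measurableSet_generateFrom ⟨k, rfl⟩)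
  -- Generators only see `{s < t_n}`; off that event `t_k ≤ t_n ≤ s` holds automatically.
  have h3 : X.pt k ⁻¹' Set.Iic s =
      ({ω | X.pt k ω ≤ s} ∩ {ω | s < X.pt n ω}) ∪ {ω | s < X.pt n ω}ᶜ := by
    ext ω
    have := (X.pt_strictMono ω).monotone hkn
    simp only [Set.mem_preimage, Set.mem_Iic, Set.mem_union, Set.mem_inter_iff, Set.mem_ofPred_eq,
      Set.mem_compl_iff, not_lt] at this ⊢
    constructor
    · intro h
      by_cases h' : s < X.pt n ω
      · exact Or.inl ⟨h, h'⟩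
      · exact Or.inr (not_lt.1 h')
    · rintro (h | h)
      · exact h.1
      · exact this.trans h
  rw [h3]
  exact MeasurableSet.union h2 h1.compl

end FlowPointProcess

/-! ### Conditional means of positive variables. -/

section CondExp

variable {α : Type*} {m m0 : MeasurableSpace α} {μ : Measure α} [IsFiniteMeasure μ]

/-- On the `m`-measurable set where the conditional mean is nonpositive, `f > 0` would have a
nonpositive integral, so the set is null. -/
theorem ae_condExp_pos (hm : m ≤ m0) {f : α → ℝ} (hf : Integrable f μ) (hpos : ∀ x, 0 < f x) :
    ∀ᵐ x ∂μ, 0 < (μ[f | m]) x := by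
  have hS : MeasurableSet[m] {x | (μ[f | m]) x ≤ 0} :=
    @measurableSet_le _ _ _ _ _ m _ _ _ _ _ stronglyMeasurable_condExp.measurable
      measurable_const
  have h1 := setIntegral_condExp hm hf hS
  have h2 : ∫ x in {x | (μ[f | m]) x ≤ 0}, (μ[f | m]) x ∂μ ≤ 0 :=
    setIntegral_nonpos (hm _ hS) fun x hx => hx
  have h3 := setIntegral_pos_iff_support_of_nonneg_ae (μ := μ) (s := {x | (μ[f | m]) x ≤ 0})
    (f := f) (ae_of_all _ fun x => (hpos x).le) hf.integrableOn
  have hsupp : Function.support f = Set.univ := by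
    ext x
    simp [(hpos x).ne']
  rw [hsupp, Set.univ_inter, ← h1] at h3
  have h4 : μ {x | (μ[f | m]) x ≤ 0} = 0 := by
    by_contra h
    exact absurd (h3.2 (pos_iff_ne_zero.2 h)) (not_lt.2 h2)
  rw [ae_iff]
  simpa using h4

/-- The measures with densities `f` and its conditional mean coincide on `m`, hence integrate
`m`-measurable functions alike; no integrability of the product is needed. -/
theorem lintegral_condLExp_mul (hm : m ≤ m0) {f g : α → ℝ≥0∞} (hf : Measurable f)
    (hg : Measurable[m] g) : ∫⁻ x, (μ⁻[f | m]) x * g x ∂μ = ∫⁻ x, f x * g x ∂μ := by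
  have h : (μ.withDensity (μ⁻[f | m])).trim hm = (μ.withDensity f).trim hm := by
    refine @Measure.ext _ m _ _ fun s hs => ?_
    rw [trim_measurableSet_eq hm hs, trim_measurableSet_eq hm hs, withDensity_apply _ (hm s hs),
      withDensity_apply _ (hm s hs), setLIntegral_condLExp hm _ _ hs]
  have h1 := lintegral_withDensity_eq_lintegral_mul μ
    (measurable_condLExp' m μ f) (hg.mono hm le_rfl)
  have h2 := lintegral_withDensity_eq_lintegral_mul μ hf (hg.mono hm le_rfl)
  simp only [Pi.mul_apply] at h1 h2
  rw [← h1, ← h2, ← lintegral_trim hm hg, ← lintegral_trim hm hg, h]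

/-- Dividing by the conditional mean normalizes: `E[f / E[f | m]; B] = μ B` for `B ∈ m`. -/
theorem setLIntegral_mul_inv_condExp (hm : m ≤ m0) {f : α → ℝ} (hf : Integrable f μ)
    (hfm : Measurable f) (hpos : ∀ x, 0 < f x) {B : Set α} (hB : MeasurableSet[m] B) :
    ∫⁻ x in B, ENNReal.ofReal (f x) * ENNReal.ofReal (1 / (μ[f | m]) x) ∂μ = μ B := by
  have hc : Measurable[m] (fun x => ENNReal.ofReal (1 / (μ[f | m]) x)) := by
    have : Measurable[m] (μ[f | m]) := stronglyMeasurable_condExp.measurable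
    exact ENNReal.measurable_ofReal.comp (this.const_div 1)
  have hg : Measurable[m] (B.indicator fun x => ENNReal.ofReal (1 / (μ[f | m]) x)) :=
    hc.indicator hB
  rw [← lintegral_indicator (hm B hB)]
  have h1 : (B.indicator fun x => ENNReal.ofReal (f x) * ENNReal.ofReal (1 / (μ[f | m]) x)) =
      fun x => ENNReal.ofReal (f x) *
        (B.indicator fun x => ENNReal.ofReal (1 / (μ[f | m]) x)) x := by
    funext x
    by_cases hx : x ∈ B <;> simp [hx]
  rw [h1, ← lintegral_condLExp_mul hm hfm.ennreal_ofReal hg, ← lintegral_indicator_one (hm B hB)]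
  refine lintegral_congr_ae ?_
  filter_upwards [ae_condExp_pos hm hf hpos,
    condLExp_ofReal m hf (ae_of_all _ fun x => (hpos x).le)] with x hx1 hx2
  by_cases hx : x ∈ B
  · simp only [hx, Set.indicator_of_mem, Pi.one_apply]
    rw [hx2, ← ENNReal.ofReal_mul hx1.le, mul_one_div_cancel hx1.ne', ENNReal.ofReal_one]
  · simp [hx]

end CondExp

/-! ### The stationary law and Campbell's formula. -/

namespace FlowPointProcess

variable {Ω : Type*} [MeasurableSpace Ω] (X : FlowPointProcess Ω)

theorem lintegral_stat (P : Measure Ω) [SFinite P] {g : Ω → ℝ≥0∞} (hg : Measurable g) :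
    ∫⁻ ω, g ω ∂(X.stat P) = ENNReal.ofReal (1 / ∫ ω, X.T 1 ω ∂P) *
      ∫⁻ ω, (∫⁻ s in Set.Ico 0 (X.T 1 ω), g (X.θ s ω)) ∂P := by
  have hm : Measurable (fun p : Ω × ℝ => X.θ p.2 p.1) := X.measurable_θ.comp measurable_swap
  have hS : MeasurableSet {p : Ω × ℝ | 0 ≤ p.2 ∧ p.2 < X.T 1 p.1} :=
    (measurableSet_le measurable_const measurable_snd).inter
      (measurableSet_lt measurable_snd ((X.measurable_T 1).comp measurable_fst))
  rw [stat, lintegral_smul_measure, lintegral_map hg hm, ← lintegral_indicator hS,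
    lintegral_prod (fun p : Ω × ℝ => {p : Ω × ℝ | 0 ≤ p.2 ∧ p.2 < X.T 1 p.1}.indicator
      (fun a => g (X.θ a.2 a.1)) p) ((hg.comp hm).indicator hS).aemeasurable, smul_eq_mul]
  congr 1
  refine lintegral_congr fun ω => ?_
  rw [← lintegral_indicator measurableSet_Ico]
  rfl

/-- The intervals between consecutive points partition the line. -/
theorem tsum_volume_inter (ω : Ω) {S : Set ℝ} (hS : MeasurableSet S) :
    ∑' n : ℤ, volume (Set.Ico (X.pt n ω) (X.pt (n + 1) ω) ∩ S) = volume S := by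
  have hmem : ∀ (n : ℤ) (x : ℝ), x ∈ Set.Ico (X.pt n ω) (X.pt (n + 1) ω) ↔
      X.nextIdx x ω = n + 1 := by
    intro n x
    rw [nextIdx_eq_iff, add_sub_cancel_right, Set.mem_Ico]
  rw [← measure_iUnion]
  · congr 1
    ext x
    simp only [Set.mem_iUnion, Set.mem_inter_iff, hmem]
    exact ⟨fun ⟨_, h⟩ => h.2, fun h => ⟨X.nextIdx x ω - 1, by ring, h⟩⟩
  · intro i j hij
    refine Set.disjoint_left.2 fun x hx hx' => hij ?_
    have h1 := (hmem i x).1 hx.1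
    have h2 := (hmem j x).1 hx'.1
    omega
  · exact fun n => measurableSet_Ico.inter hS

/-- Campbell's formula relating the stationary law to the Palm distribution. -/
theorem lintegral_stat_tsum_pt (P : Measure Ω) [SFinite P] (h0 : ∀ᵐ ω ∂P, X.pt 0 ω = 0)
    (hPalm : ∀ n : ℤ, MeasurePreserving (fun ω => X.θ (X.pt n ω) ω) P P)
    {f : Ω → ℝ≥0∞} (hf : Measurable f) (u : ℝ) :
    ∫⁻ ω, ∑' n : ℤ, (Set.Ioc 0 u).indicator 1 (X.pt n ω) * f (X.θ (X.pt n ω) ω) ∂(X.stat P) =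
      ENNReal.ofReal (1 / ∫ ω, X.T 1 ω ∂P) * (ENNReal.ofReal u * ∫⁻ ω, f ω ∂P) := by
  have hind : Measurable ((Set.Ioc 0 u).indicator (1 : ℝ → ℝ≥0∞)) :=
    measurable_one.indicator measurableSet_Ioc
  have hmeas : ∀ n, Measurable fun ω => f (X.θ (X.pt n ω) ω) := fun n =>
    hf.comp (X.measurable_θ_pt n)
  have hshift : ∀ s ω, ∑' n : ℤ, (Set.Ioc 0 u).indicator 1 (X.pt n (X.θ s ω)) *
      f (X.θ (X.pt n (X.θ s ω)) (X.θ s ω)) =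
      ∑' n : ℤ, (Set.Ioc 0 u).indicator (1 : ℝ → ℝ≥0∞) (X.pt n ω - s) *
        f (X.θ (X.pt n ω) ω) := by
    intro s ω
    rw [← (Equiv.addRight (X.nextIdx s ω - 1)).tsum_eq fun n : ℤ =>
      (Set.Ioc 0 u).indicator (1 : ℝ → ℝ≥0∞) (X.pt n ω - s) * f (X.θ (X.pt n ω) ω)]
    refine tsum_congr fun n => ?_
    rw [θ_pt_θ, pt_θ]
    simp only [Equiv.coe_addRight, add_sub_assoc]
  -- Seen from `t_n`, the cycle `[t_0, t_1)` becomes `[t_{-n}, t_{-n+1})`, and the positions `s`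
  -- with `t_n - s ∈ (0, u]` become `[-u, 0)`. Palm invariance then removes the shift, and summing
  -- over `n` recovers the full length `u`.
  set K : ℤ → Ω → ℝ≥0∞ := fun n ω =>
    f ω * volume (Set.Ico (X.pt (-n) ω) (X.pt (-n + 1) ω) ∩ Set.Ico (-u) 0) with hK
  have hKm : ∀ n, Measurable (K n) := by
    intro n
    simp only [hK, Set.Ico_inter_Ico, Real.volume_Ico]
    exact hf.mul (((X.measurable_pt _).min measurable_const).sub
      ((X.measurable_pt _).max measurable_const)).ennreal_ofReal
  have hinner : ∀ ω, X.pt 0 ω = 0 →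
      ∫⁻ s in Set.Ico 0 (X.T 1 ω), ∑' n : ℤ, (Set.Ioc 0 u).indicator 1 (X.pt n (X.θ s ω)) *
        f (X.θ (X.pt n (X.θ s ω)) (X.θ s ω)) = ∑' n : ℤ, K n (X.θ (X.pt n ω) ω) := by
    intro ω hω
    simp_rw [hshift]
    have hm : ∀ n : ℤ,
        Measurable fun s => (Set.Ioc 0 u).indicator (1 : ℝ → ℝ≥0∞) (X.pt n ω - s) := fun n =>
      hind.comp (measurable_const.sub measurable_id)
    rw [lintegral_tsum fun n => ((hm n).mul_const _).aemeasurable]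
    refine tsum_congr fun n => ?_
    rw [lintegral_mul_const _ (hm n), mul_comm]
    simp only [hK, pt_θ_pt]
    congr 1
    have h1 : (fun s => (Set.Ioc 0 u).indicator (1 : ℝ → ℝ≥0∞) (X.pt n ω - s)) =
        (Set.Ico (X.pt n ω - u) (X.pt n ω)).indicator 1 := by
      funext s
      have : X.pt n ω - s ∈ Set.Ioc 0 u ↔ s ∈ Set.Ico (X.pt n ω - u) (X.pt n ω) := by
        simp only [Set.mem_Ioc, Set.mem_Ico]
        constructor <;> rintro ⟨h1, h2⟩ <;> constructor <;> linarith
      by_cases h : s ∈ Set.Ico (X.pt n ω - u) (X.pt n ω)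
      · rw [Set.indicator_of_mem h, Set.indicator_of_mem (this.2 h)]; rfl
      · rw [Set.indicator_of_notMem h, Set.indicator_of_notMem fun h' => h (this.1 h')]
    rw [h1, lintegral_indicator_one measurableSet_Ico, Measure.restrict_apply measurableSet_Ico,
      Set.inter_comm, Set.Ico_inter_Ico, Set.Ico_inter_Ico, Real.volume_Ico, Real.volume_Ico, T,
      neg_add_cancel, show -n + 1 + n = 1 by ring, show (1 : ℤ) - 1 = 0 from rfl, hω, sub_zero]
    congr 1
    have e1 : min (X.pt 1 ω - X.pt n ω) 0 = min (X.pt 1 ω) (X.pt n ω) - X.pt n ω := by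
      rw [← min_sub_sub_right, sub_self]
    have e2 : max (0 - X.pt n ω) (-u) = max 0 (X.pt n ω - u) - X.pt n ω := by
      rw [← max_sub_sub_right]; congr 1; ring
    rw [e1, e2]; ring
  have hGm : Measurable fun ω => ∑' n : ℤ, (Set.Ioc 0 u).indicator (1 : ℝ → ℝ≥0∞) (X.pt n ω) *
      f (X.θ (X.pt n ω) ω) :=
    Measurable.tsum fun n => (hind.comp (X.measurable_pt n)).mul (hmeas n)
  rw [X.lintegral_stat P hGm]
  congr 1
  have hKθ : ∀ n, Measurable fun ω => K n (X.θ (X.pt n ω) ω) := fun n =>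
    (hKm n).comp (X.measurable_θ_pt n)
  rw [lintegral_congr_ae (h0.mono hinner), lintegral_tsum fun n => (hKθ n).aemeasurable]
  simp_rw [fun n => (hPalm n).lintegral_comp (hKm n)]
  rw [← lintegral_tsum fun n => (hKm n).aemeasurable, ← lintegral_const_mul _ hf]
  refine lintegral_congr fun ω => ?_
  simp only [hK]
  rw [ENNReal.tsum_mul_left, mul_comm]
  congr 1
  rw [← (Equiv.neg ℤ).tsum_eq]
  simp only [Equiv.neg_apply, neg_neg]
  rw [X.tsum_volume_inter ω measurableSet_Ico, Real.volume_Ico, sub_neg_eq_add, zero_add]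

theorem integral_T_pos (P : Measure Ω) [IsProbabilityMeasure P] (hT : Integrable (X.T 1) P) :
    0 < ∫ ω, X.T 1 ω ∂P := by
  rw [integral_pos_iff_support_of_nonneg (fun ω => (X.T_pos 1 ω).le) hT]
  have : Function.support (X.T 1) = Set.univ := by
    ext ω
    simp [(X.T_pos 1 ω).ne']
  simp [this]

theorem isProbabilityMeasure_stat (P : Measure Ω) [IsProbabilityMeasure P]
    (hT : Integrable (X.T 1) P) : IsProbabilityMeasure (X.stat P) := by
  have hpos := X.integral_T_pos P hT
  refine ⟨?_⟩
  rw [← lintegral_one, X.lintegral_stat P measurable_const]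
  simp only [lintegral_one, Measure.restrict_apply_univ, Real.volume_Ico, sub_zero]
  rw [← ofReal_integral_eq_lintegral_ofReal hT (ae_of_all _ fun ω => (X.T_pos 1 ω).le),
    ← ENNReal.ofReal_mul (by positivity), one_div_mul_cancel hpos.ne', ENNReal.ofReal_one]

theorem nextIdx_of_mem {ω : Ω} (hω : X.pt 0 ω = 0) {s : ℝ} (hs : s ∈ Set.Ico 0 (X.T 1 ω)) :
    X.nextIdx s ω = 1 := by
  rw [nextIdx_eq_iff]
  have h := hs.2
  simp only [T, sub_self, hω, sub_zero] at h ⊢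
  exact ⟨hs.1, h⟩

theorem pt_one_θ_of_mem {ω : Ω} (hω : X.pt 0 ω = 0) {s : ℝ} (hs : s ∈ Set.Ico 0 (X.T 1 ω)) :
    X.pt 1 (X.θ s ω) = X.T 1 ω - s := by
  rw [pt_θ, X.nextIdx_of_mem hω hs, T]
  simp [hω]

theorem setLIntegral_Ico_sub_le (a u : ℝ) :
    ∫⁻ s in Set.Ico 0 a, (Set.Iic u).indicator (1 : ℝ → ℝ≥0∞) (a - s) =
      ENNReal.ofReal (min a u) := by
  have h : (fun s => (Set.Iic u).indicator (1 : ℝ → ℝ≥0∞) (a - s)) =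
      (Set.Ici (a - u)).indicator 1 := by
    funext s
    have : a - s ∈ Set.Iic u ↔ s ∈ Set.Ici (a - u) := by
      simp only [Set.mem_Iic, Set.mem_Ici]
      constructor <;> intro h <;> linarith
    by_cases h : s ∈ Set.Ici (a - u)
    · rw [Set.indicator_of_mem h, Set.indicator_of_mem (this.2 h)]; rfl
    · rw [Set.indicator_of_notMem h, Set.indicator_of_notMem fun h' => h (this.1 h')]
  rw [h, lintegral_indicator_one measurableSet_Ici, Measure.restrict_apply measurableSet_Ici]
  have h2 : Set.Ici (a - u) ∩ Set.Ico 0 a = Set.Ico (max (a - u) 0) a := by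
    ext x
    simp only [Set.mem_inter_iff, Set.mem_Ici, Set.mem_Ico, max_le_iff]
    tauto
  rw [h2, Real.volume_Ico]
  congr 1
  rcases le_total a u with h | h
  · rw [max_eq_right (by linarith), min_eq_left h, sub_zero]
  · rw [max_eq_left (by linarith), min_eq_right h]; ring

/-- From position `s` in the cycle the next point is at distance `T_1 - s`, which is at most `u` on
a set of length `min(T_1, u)`. -/
theorem stat_pt_one_le (P : Measure Ω) [IsProbabilityMeasure P] (h0 : ∀ᵐ ω ∂P, X.pt 0 ω = 0)
    {u : ℝ} (hu : 0 < u) :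
    (X.stat P).real {ω | X.pt 1 ω ≤ u} =
      1 / (∫ ω, X.T 1 ω ∂P) * ∫ ω, X.Ttrunc u 1 ω ∂P := by
  have hS : MeasurableSet {ω | X.pt 1 ω ≤ u} := measurableSet_le (X.measurable_pt 1) measurable_const
  have h1 : X.stat P {ω | X.pt 1 ω ≤ u} = ENNReal.ofReal (1 / ∫ ω, X.T 1 ω ∂P) *
      ∫⁻ ω, ENNReal.ofReal (X.Ttrunc u 1 ω) ∂P := by
    rw [← lintegral_indicator_one hS, X.lintegral_stat P (measurable_one.indicator hS)]
    congr 1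
    refine lintegral_congr_ae (h0.mono fun ω hω => ?_)
    simp only [Ttrunc]
    rw [← setLIntegral_Ico_sub_le]
    refine setLIntegral_congr_fun measurableSet_Ico fun s hs => ?_
    simp only [Set.indicator_apply, Set.mem_ofPred_eq, X.pt_one_θ_of_mem hω hs, Set.mem_Iic,
      Pi.one_apply]
  rw [measureReal_def, h1, ← ofReal_integral_eq_lintegral_ofReal (X.integrable_Ttrunc P hu 1)
    (ae_of_all _ fun ω => (X.Ttrunc_pos hu 1 ω).le), ← ENNReal.ofReal_mul, ENNReal.toReal_ofReal]
  · exact mul_nonneg (one_div_nonneg.2 (integral_nonneg fun ω => (X.T_pos 1 ω).le))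
      (integral_nonneg fun ω => (X.Ttrunc_pos hu 1 ω).le)
  · exact one_div_nonneg.2 (integral_nonneg fun ω => (X.T_pos 1 ω).le)

/-- Since `T_1 > 0`, the ratio `min(T_1, u) / u` is bounded by one and eventually equal to one.
Hence several points in `(0, u]` cost only `o(u)`. -/
theorem tendsto_integral_Ttrunc_div (P : Measure Ω) [IsProbabilityMeasure P] {u : ℕ → ℝ}
    (hu : ∀ m, 0 < u m) (hlim : Tendsto u atTop (𝓝 0)) :
    Tendsto (fun m => (∫ ω, X.Ttrunc (u m) 1 ω ∂P) / u m) atTop (𝓝 1) := by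
  have h1 : (1 : ℝ) = ∫ _ω : Ω, (1 : ℝ) ∂P := by simp
  simp_rw [← integral_div]
  rw [h1]
  refine tendsto_integral_of_dominated_convergence (fun _ => (1 : ℝ))
    (fun m => ((X.measurable_Ttrunc _ 1).div_const _).aestronglyMeasurable)
    (integrable_const _) (fun m => ae_of_all _ fun ω => ?_) (ae_of_all _ fun ω => ?_)
  · rw [Real.norm_eq_abs, abs_of_pos (div_pos (X.Ttrunc_pos (hu m) 1 ω) (hu m)),
      div_le_one (hu m)]
    exact min_le_right _ _
  · refine tendsto_const_nhds.congr' ?_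
    filter_upwards [hlim.eventually (eventually_lt_nhds (X.T_pos 1 ω))] with m hm
    rw [Ttrunc, min_eq_right hm.le, div_self (hu m).ne']

/-! ### Convergence of Palm probabilities to stationary ones. -/

/-- If `t_1 > u`, there is no point in `(0, u]`. -/
theorem pt_notMem_Ioc {ω : Ω} {u : ℝ} (h : u < X.pt 1 ω) (n : ℤ) : X.pt n ω ∉ Set.Ioc 0 u := by
  rintro ⟨h1, h2⟩
  have h3 : n < 1 := (X.pt_strictMono ω).lt_iff_lt.1 (h2.trans_lt h)
  have h4 := (X.pt_strictMono ω).monotone (show n ≤ 0 by omega)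
  exact absurd (h4.trans (X.pt_zero_nonpos ω)) (not_le.2 h1)

theorem measurableSet_pt_le (k : ℤ) (h : ℝ) : MeasurableSet {ω | X.pt k ω ≤ h} :=
  measurableSet_le (X.measurable_pt k) measurable_const

theorem measurableSet_pt_θ_le (k : ℤ) (s h : ℝ) : MeasurableSet {ω | X.pt k (X.θ s ω) ≤ h} :=
  X.measurable_θ_left s (X.measurableSet_pt_le k h)

/-- Campbell's formula turns this into a pointwise inequality. If the `k`-th point after `t` is
beyond `t + h + u`, no point of `(0, u]` contributes, by monotonicity; otherwise the contributions
are at most the number of points in `(0, u]`. The additive form avoids subtraction in `ℝ≥0∞`. -/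
theorem palm_mul_le (P : Measure Ω) [IsProbabilityMeasure P] (h0 : ∀ᵐ ω ∂P, X.pt 0 ω = 0)
    (hPalm : ∀ n : ℤ, MeasurePreserving (fun ω => X.θ (X.pt n ω) ω) P P)
    (k : ℤ) (h t u : ℝ) :
    ENNReal.ofReal (1 / ∫ ω, X.T 1 ω ∂P) * (ENNReal.ofReal u * P {ω | X.pt k (X.θ t ω) ≤ h}) +
        X.stat P {ω | X.pt 1 ω ≤ u} ≤
      X.stat P ({ω | X.θ t ω ∈ {ω | X.pt k ω ≤ h + u}} ∩ {ω | X.pt 1 ω ≤ u}) +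
        ENNReal.ofReal (1 / ∫ ω, X.T 1 ω ∂P) * ENNReal.ofReal u := by
  have hB := X.measurableSet_pt_θ_le k t h
  have hE := X.measurableSet_pt_le 1 u
  have hA : MeasurableSet ({ω | X.θ t ω ∈ {ω | X.pt k ω ≤ h + u}} ∩ {ω | X.pt 1 ω ≤ u}) :=
    (X.measurableSet_pt_θ_le k t (h + u)).inter hE
  have hind : Measurable ((Set.Ioc 0 u).indicator (1 : ℝ → ℝ≥0∞)) :=
    measurable_one.indicator measurableSet_Ioc
  have hf : Measurable ({ω | X.pt k (X.θ t ω) ≤ h}.indicator (1 : Ω → ℝ≥0∞)) :=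
    measurable_one.indicator hB
  have h1 := X.lintegral_stat_tsum_pt P h0 hPalm hf u
  have h2 := X.lintegral_stat_tsum_pt P h0 hPalm (f := 1) measurable_one u
  rw [lintegral_indicator_one hB] at h1
  simp only [Pi.one_apply, mul_one, lintegral_one, measure_univ] at h2
  rw [← h1, ← h2, ← lintegral_indicator_one hE, ← lintegral_indicator_one hA,
    ← lintegral_add_right _ (measurable_one.indicator hE),
    ← lintegral_add_left (measurable_one.indicator hA)]
  refine lintegral_mono fun ω => ?_
  by_cases hu : X.pt 1 ω ≤ u
  swap
  · have hz : ∀ n, (Set.Ioc 0 u).indicator (1 : ℝ → ℝ≥0∞) (X.pt n ω) = 0 := fun n =>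
      Set.indicator_of_notMem (X.pt_notMem_Ioc (not_le.1 hu) n) _
    simp [hz, hu]
  by_cases hA' : X.pt k (X.θ t ω) ≤ h + u
  · have e1 : ({ω | X.θ t ω ∈ {ω | X.pt k ω ≤ h + u}} ∩ {ω | X.pt 1 ω ≤ u}).indicator
        (1 : Ω → ℝ≥0∞) ω = 1 := Set.indicator_of_mem (show ω ∈
          {ω | X.θ t ω ∈ {ω | X.pt k ω ≤ h + u}} ∩ {ω | X.pt 1 ω ≤ u} from ⟨hA', hu⟩) _
    have e2 : {ω | X.pt 1 ω ≤ u}.indicator (1 : Ω → ℝ≥0∞) ω = 1 :=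
      Set.indicator_of_mem (show ω ∈ {ω | X.pt 1 ω ≤ u} from hu) _
    rw [e1, e2, add_comm]
    gcongr with n
    refine mul_le_of_le_one_right' ?_
    exact Set.indicator_le_self' (fun _ _ => zero_le) _
  · have hz : ∀ n, (Set.Ioc 0 u).indicator (1 : ℝ → ℝ≥0∞) (X.pt n ω) *
        {ω | X.pt k (X.θ t ω) ≤ h}.indicator (1 : Ω → ℝ≥0∞) (X.θ (X.pt n ω) ω) = 0 := by
      intro n
      by_cases hn : X.pt n ω ∈ Set.Ioc 0 u
      · rw [Set.indicator_of_notMem (s := {ω | X.pt k (X.θ t ω) ≤ h}), mul_zero]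
        simp only [Set.mem_ofPred_eq, ← X.θ_add]
        intro hle
        have := X.monotone_add_pt_θ k ω (show t ≤ t + X.pt n ω by linarith [hn.1])
        simp only at this
        linarith [hn.2]
      · rw [Set.indicator_of_notMem hn, zero_mul]
    simp only [hz, tsum_zero, zero_add]
    refine le_trans ?_ le_add_self
    refine le_trans (le_of_eq ?_) (ENNReal.le_tsum 1)
    rw [Set.indicator_of_mem (show X.pt 1 ω ∈ Set.Ioc 0 u from ⟨X.pt_one_pos ω, hu⟩),
      Set.indicator_of_mem (show ω ∈ {ω | X.pt 1 ω ≤ u} from hu)]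
    rfl

/-- In Campbell's sum it suffices to keep the term of `t_1`: as `t + t_1 ≤ t + u`, the `k`-th point
after `t + t_1` is no later than the one after `t + u`. -/
theorem le_palm_mul (P : Measure Ω) [IsProbabilityMeasure P] (h0 : ∀ᵐ ω ∂P, X.pt 0 ω = 0)
    (hPalm : ∀ n : ℤ, MeasurePreserving (fun ω => X.θ (X.pt n ω) ω) P P)
    (k : ℤ) (h t u : ℝ) :
    X.stat P ({ω | X.θ t ω ∈ {ω | u + X.pt k (X.θ u ω) ≤ h}} ∩ {ω | X.pt 1 ω ≤ u}) ≤
      ENNReal.ofReal (1 / ∫ ω, X.T 1 ω ∂P) *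
        (ENNReal.ofReal u * P {ω | X.pt k (X.θ t ω) ≤ h}) := by
  have hB := X.measurableSet_pt_θ_le k t h
  have hC : MeasurableSet {ω | u + X.pt k (X.θ u ω) ≤ h} :=
    measurableSet_le (((X.measurable_pt k).comp (X.measurable_θ_left u)).const_add u)
      measurable_const
  have hA : MeasurableSet ({ω | X.θ t ω ∈ {ω | u + X.pt k (X.θ u ω) ≤ h}} ∩
      {ω | X.pt 1 ω ≤ u}) :=
    (X.measurable_θ_left t hC).inter (X.measurableSet_pt_le 1 u)
  have h1 := X.lintegral_stat_tsum_pt P h0 hPalm (measurable_one.indicator hB) u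
  rw [lintegral_indicator_one hB] at h1
  rw [← h1, ← lintegral_indicator_one hA]
  refine lintegral_mono fun ω => ?_
  by_cases hω : ω ∈ {ω | X.θ t ω ∈ {ω | u + X.pt k (X.θ u ω) ≤ h}} ∩ {ω | X.pt 1 ω ≤ u}
  swap
  · rw [Set.indicator_of_notMem hω]
    exact zero_le
  rw [Set.indicator_of_mem hω]
  refine le_trans (le_of_eq ?_) (ENNReal.le_tsum 1)
  have hu : X.pt 1 ω ≤ u := hω.2
  have hk : u + X.pt k (X.θ u (X.θ t ω)) ≤ h := hω.1
  rw [← X.θ_add] at hk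
  have := X.monotone_add_pt_θ k ω (show t + X.pt 1 ω ≤ u + t by linarith)
  simp only at this
  have hmem : X.θ (X.pt 1 ω) ω ∈ {ω | X.pt k (X.θ t ω) ≤ h} := by
    simp only [Set.mem_ofPred_eq, ← X.θ_add]
    linarith [X.pt_one_pos ω]
  rw [Set.indicator_of_mem (show X.pt 1 ω ∈ Set.Ioc 0 u from ⟨X.pt_one_pos ω, hu⟩),
    Set.indicator_of_mem hmem]
  simp

/-- Under the Palm distribution, the points seen from `t` converge in law, as `t → ∞`, to the
points under the stationary law. -/
theorem tendsto_palm_pt_θ_le (P : Measure Ω) [IsProbabilityMeasure P]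
    (h0 : ∀ᵐ ω ∂P, X.pt 0 ω = 0) (hT : Integrable (X.T 1) P)
    (hPalm : ∀ n : ℤ, MeasurePreserving (fun ω => X.θ (X.pt n ω) ω) P P)
    (hMix : ∀ A : Set Ω, MeasurableSet A → ∀ u : ℝ, 0 ≤ u →
      Tendsto (fun t : ℝ => X.stat P ({ω | X.θ t ω ∈ A} ∩ {ω | X.pt 1 ω ≤ u})) atTop
        (𝓝 (X.stat P A * X.stat P {ω | X.pt 1 ω ≤ u})))
    (k : ℤ) (h : ℝ) :
    Tendsto (fun t : ℝ => P.real {ω | X.pt k (X.θ t ω) ≤ h}) atTop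
      (𝓝 ((X.stat P).real {ω | X.pt k ω ≤ h})) := by
  have := X.isProbabilityMeasure_stat P hT
  have hE := X.integral_T_pos P hT
  have hmix : ∀ A : Set Ω, MeasurableSet A → ∀ u : ℝ, 0 < u →
      Tendsto (fun t : ℝ => (X.stat P).real ({ω | X.θ t ω ∈ A} ∩ {ω | X.pt 1 ω ≤ u})) atTop
        (𝓝 ((X.stat P).real A * (X.stat P).real {ω | X.pt 1 ω ≤ u})) := by
    intro A hA u hu
    have := (ENNReal.tendsto_toReal (by finiteness)).comp (hMix A hA u hu.le)
    rw [ENNReal.toReal_mul] at this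
    exact this
  set l := 1 / ∫ ω, X.T 1 ω ∂P with hl
  have hlpos : 0 < l := by positivity
  set u : ℕ → ℝ := fun m => 1 / ((m : ℝ) + 1) with hu_def
  have hu : ∀ m, 0 < u m := fun m => by positivity
  have hulim : Tendsto u atTop (𝓝 0) := tendsto_one_div_add_atTop_nhds_zero_nat
  have huanti : Antitone u := fun a b hab => by
    simp only [hu_def]
    gcongr
  set c : ℕ → ℝ := fun m => (∫ ω, X.Ttrunc (u m) 1 ω ∂P) / u m with hc
  have hclim : Tendsto c atTop (𝓝 1) := X.tendsto_integral_Ttrunc_div P hu hulim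
  have hp : ∀ m, (X.stat P).real {ω | X.pt 1 ω ≤ u m} = l * u m * c m := by
    intro m
    rw [X.stat_pt_one_le P h0 (hu m), hc, mul_assoc, mul_div_cancel₀ _ (hu m).ne']
  set q := (X.stat P).real {ω | X.pt k ω ≤ h} with hq
  have hup : Tendsto (fun m => (X.stat P).real {ω | X.pt k ω ≤ h + u m}) atTop (𝓝 q) := by
    have hI : ⋂ m, {ω | X.pt k ω ≤ h + u m} = {ω | X.pt k ω ≤ h} := by
      ext ω
      simp only [Set.mem_iInter, Set.mem_ofPred_eq]
      refine ⟨fun hm => ge_of_tendsto' (by simpa using hulim.const_add h) hm, fun hm m => ?_⟩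
      linarith [hu m]
    have := tendsto_measure_iInter_atTop (μ := X.stat P)
      (s := fun m => {ω | X.pt k ω ≤ h + u m})
      (fun m => (X.measurableSet_pt_le k _).nullMeasurableSet)
      (fun a b hab ω hω => show X.pt k ω ≤ h + u a from
        le_trans (show X.pt k ω ≤ h + u b from hω) (by linarith [huanti hab])) ⟨0, by finiteness⟩
    rw [hI] at this
    exact (ENNReal.tendsto_toReal (by finiteness)).comp this
  have hC : ∀ v, MeasurableSet {ω | v + X.pt k (X.θ v ω) ≤ h} := fun v =>
    measurableSet_le (((X.measurable_pt k).comp (X.measurable_θ_left v)).const_add v)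
      measurable_const
  -- Once `u m < t_1`, moving the origin by `u m` renumbers nothing, so these events increase to the
  -- target itself. No continuity of the limit law at `h` is required.
  have hlow : Tendsto (fun m => (X.stat P).real {ω | u m + X.pt k (X.θ (u m) ω) ≤ h}) atTop
      (𝓝 q) := by
    have hU : ⋃ m, {ω | u m + X.pt k (X.θ (u m) ω) ≤ h} = {ω | X.pt k ω ≤ h} := by
      ext ω
      simp only [Set.mem_iUnion, Set.mem_ofPred_eq]
      constructor
      · rintro ⟨m, hm⟩
        have := X.monotone_add_pt_θ k ω (hu m).le
        simp only [X.θ_zero, zero_add] at this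
        exact this.trans hm
      · intro hω
        obtain ⟨m, hm⟩ := (hulim.eventually (eventually_lt_nhds (X.pt_one_pos ω))).exists
        refine ⟨m, ?_⟩
        have hn : X.nextIdx (u m) ω = 1 := by
          rw [nextIdx_eq_iff]
          exact ⟨(X.pt_zero_nonpos ω).trans (hu m).le, hm⟩
        rw [pt_θ, hn]
        simpa using hω
    have := tendsto_measure_iUnion_atTop (μ := X.stat P)
      (s := fun m => {ω | u m + X.pt k (X.θ (u m) ω) ≤ h})
      (fun a b hab ω hω => (X.monotone_add_pt_θ k ω (huanti hab)).trans hω)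
    rw [hU] at this
    exact (ENNReal.tendsto_toReal (by finiteness)).comp this
  have hupper : ∀ m t, l * u m * P.real {ω | X.pt k (X.θ t ω) ≤ h} ≤
      (X.stat P).real ({ω | X.θ t ω ∈ {ω | X.pt k ω ≤ h + u m}} ∩ {ω | X.pt 1 ω ≤ u m}) +
        l * u m * (1 - c m) := by
    intro m t
    have := ENNReal.toReal_mono (by finiteness) (X.palm_mul_le P h0 hPalm k h t (u m))
    rw [ENNReal.toReal_add (by finiteness) (by finiteness),
      ENNReal.toReal_add (by finiteness) (by finiteness), ENNReal.toReal_mul, ENNReal.toReal_mul,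
      ENNReal.toReal_mul, ENNReal.toReal_ofReal hlpos.le, ENNReal.toReal_ofReal (hu m).le] at this
    simp only [← measureReal_def] at this
    rw [hp m] at this
    linarith
  have hlower : ∀ m t,
      (X.stat P).real ({ω | X.θ t ω ∈ {ω | u m + X.pt k (X.θ (u m) ω) ≤ h}} ∩
        {ω | X.pt 1 ω ≤ u m}) ≤ l * u m * P.real {ω | X.pt k (X.θ t ω) ≤ h} := by
    intro m t
    have := ENNReal.toReal_mono (by finiteness) (X.le_palm_mul P h0 hPalm k h t (u m))
    rw [ENNReal.toReal_mul, ENNReal.toReal_mul, ENNReal.toReal_ofReal hlpos.le,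
      ENNReal.toReal_ofReal (hu m).le] at this
    simp only [← measureReal_def] at this
    linarith
  -- For each strict bound, `m` is fixed first, and only then `t → ∞` by mixing.
  rw [tendsto_order]
  constructor
  · intro b hb
    have h1 : Tendsto (fun m => (X.stat P).real {ω | u m + X.pt k (X.θ (u m) ω) ≤ h} * c m) atTop
        (𝓝 q) := by simpa using hlow.mul hclim
    obtain ⟨m, hm⟩ := (h1.eventually (lt_mem_nhds hb)).exists
    have h2 := hmix _ (hC (u m)) (u m) (hu m)
    rw [hp m] at h2
    have hlu : 0 < l * u m := mul_pos hlpos (hu m)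
    have h3 : l * u m * b < (X.stat P).real {ω | u m + X.pt k (X.θ (u m) ω) ≤ h} *
        (l * u m * c m) := by
      have := mul_lt_mul_of_pos_left hm hlu
      linarith
    filter_upwards [h2.eventually (lt_mem_nhds h3)] with t ht
    exact lt_of_mul_lt_mul_left (ht.trans_le (hlower m t)) hlu.le
  · intro b hb
    have h1 : Tendsto (fun m => (X.stat P).real {ω | X.pt k ω ≤ h + u m} * c m + (1 - c m)) atTop
        (𝓝 q) := by simpa using (hup.mul hclim).add (hclim.const_sub 1)
    obtain ⟨m, hm⟩ := (h1.eventually (gt_mem_nhds hb)).exists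
    have h2 := (hmix _ (X.measurableSet_pt_le k (h + u m)) (u m) (hu m)).add_const
      (l * u m * (1 - c m))
    rw [hp m] at h2
    have hlu : 0 < l * u m := mul_pos hlpos (hu m)
    have h3 : (X.stat P).real {ω | X.pt k ω ≤ h + u m} * (l * u m * c m) + l * u m * (1 - c m) <
        l * u m * b := by
      have := mul_lt_mul_of_pos_left hm hlu
      linarith
    filter_upwards [h2.eventually (gt_mem_nhds h3)] with t ht
    exact lt_of_mul_lt_mul_left ((hupper m t).trans_lt ht) hlu.le

/-! ### Uniform integrability of the counts. -/

/-- The expected number of points in `(t, t + h]` beyond the `K`-th one is controlled by the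
process `tildeLam` on the event that there are more than `K` points. -/
theorem tsum_palm_le_lintegral_tildeLam (P : Measure Ω) [IsProbabilityMeasure P] {v : ℝ}
    (hv : 0 < v) (K : ℕ) (t h : ℝ) :
    ∑' j : ℕ, P {ω | X.pt (K + 1 + j) (X.θ t ω) ≤ h} ≤
      ∫⁻ s in Set.Ico t (t + h + v), ∫⁻ ω in {ω | X.pt (K + 1) (X.θ t ω) ≤ h},
        ENNReal.ofReal (X.tildeLam P v s ω) ∂P := by
  -- `t_n` lies in the window with at least `K` earlier points there. Only points up to `t_n` enter,
  -- so the event is known strictly before `t_n`.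
  set B : ℤ → Set Ω := fun n => {ω | t < X.pt (n - K) ω} ∩ {ω | X.pt n ω ≤ t + h} with hB
  have hBF : ∀ n, MeasurableSet[X.Fpre (X.pt n)] (B n) := fun n =>
    MeasurableSet.inter (X.measurable_pt_Fpre (show n - K ≤ n by omega) measurableSet_Ioi)
      (X.measurable_pt_Fpre le_rfl measurableSet_Iic)
  have hBm : ∀ n, MeasurableSet (B n) := fun n => X.Fpre_le (X.measurable_pt n) _ (hBF n)
  have hDm := X.measurableSet_pt_θ_le (K + 1) t h
  set c : ℤ → Ω → ℝ := fun n => P[X.Ttrunc v (n + 1) | X.Fpre (X.pt n)] with hc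
  have hcm : ∀ n, Measurable (c n) := fun n =>
    (stronglyMeasurable_condExp.mono (X.Fpre_le (X.measurable_pt n))).measurable
  set S : ℤ → Set (Ω × ℝ) := fun n =>
    {p | p.1 ∈ B n} ∩ ({p | X.pt n p.1 ≤ p.2} ∩ {p | p.2 < X.pt n p.1 + X.Ttrunc v (n + 1) p.1})
    with hS
  have hSm : ∀ n, MeasurableSet (S n) := fun n =>
    (measurable_fst (hBm n)).inter ((measurableSet_le ((X.measurable_pt n).comp measurable_fst)
      measurable_snd).inter (measurableSet_lt measurable_snd
      (((X.measurable_pt n).add (X.measurable_Ttrunc v (n + 1))).comp measurable_fst)))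
  set Φ : ℤ → Ω × ℝ → ℝ≥0∞ := fun n =>
    (S n).indicator fun p => ENNReal.ofReal (1 / c n p.1) with hΦ
  have hΦm : ∀ n, Measurable (Φ n) := fun n =>
    (((hcm n).const_div 1).ennreal_ofReal.comp measurable_fst).indicator (hSm n)
  -- counting the points by their index in the whole process
  have hcount : ∑' j : ℕ, P {ω | X.pt (K + 1 + j) (X.θ t ω) ≤ h} ≤ ∑' n : ℤ, P (B n) := by
    simp_rw [← lintegral_indicator_one (X.measurableSet_pt_θ_le _ t h),
      ← lintegral_indicator_one (hBm _)]
    rw [← lintegral_tsum fun n =>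
        (measurable_one.indicator (X.measurableSet_pt_θ_le _ t h)).aemeasurable,
      ← lintegral_tsum fun n => (measurable_one.indicator (hBm n)).aemeasurable]
    refine lintegral_mono fun ω => ?_
    have hinj : Function.Injective fun j : ℕ => X.nextIdx t ω + K + j := fun a b hab => by
      simp only at hab
      omega
    refine le_trans (ENNReal.tsum_le_tsum fun j => ?_)
      (ENNReal.tsum_comp_le_tsum_of_injective hinj fun n => (B n).indicator 1 ω)
    by_cases hj : ω ∈ {ω | X.pt (K + 1 + j) (X.θ t ω) ≤ h}
    · have hmem : ω ∈ B (X.nextIdx t ω + K + j) := by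
        refine ⟨?_, ?_⟩
        · simp only [Set.mem_ofPred_eq, lt_pt_iff]
          omega
        · simp only [Set.mem_ofPred_eq, pt_θ] at hj ⊢
          rw [show (X.nextIdx t ω + K + j : ℤ) = K + 1 + j + X.nextIdx t ω - 1 by ring]
          linarith
      rw [Set.indicator_of_mem hj, Set.indicator_of_mem hmem]
    · rw [Set.indicator_of_notMem hj]
      exact zero_le
  -- `T_{n+1}^{(v)}` is written as the length of an interval starting at `t_n`; truncation at `v`
  -- keeps it inside `[t, t + h + v)`.
  have hterm : ∀ n, P (B n) = ∫⁻ ω, ∫⁻ s in Set.Ico t (t + h + v), Φ n (ω, s) ∂volume ∂P := by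
    intro n
    rw [← setLIntegral_mul_inv_condExp (X.Fpre_le (X.measurable_pt n))
      (X.integrable_Ttrunc P hv (n + 1)) (X.measurable_Ttrunc v (n + 1))
      (X.Ttrunc_pos hv (n + 1)) (hBF n), ← lintegral_indicator (hBm n)]
    refine lintegral_congr fun ω => ?_
    by_cases hω : ω ∈ B n
    · rw [Set.indicator_of_mem hω]
      have h1 : (fun s => Φ n (ω, s)) =
          (Set.Ico (X.pt n ω) (X.pt n ω + X.Ttrunc v (n + 1) ω)).indicator
            fun _ => ENNReal.ofReal (1 / c n ω) := by
        funext s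
        simp only [hΦ, hS, Set.indicator_apply, Set.mem_inter_iff, Set.mem_ofPred_eq, hω, true_and,
          Set.mem_Ico]
      rw [h1, lintegral_indicator measurableSet_Ico, setLIntegral_const,
        Measure.restrict_apply measurableSet_Ico, Set.inter_eq_left.2, Real.volume_Ico,
        add_sub_cancel_left, mul_comm]
      have h2 : t < X.pt n ω := lt_of_lt_of_le hω.1 ((X.pt_strictMono ω).monotone (by omega))
      have h3 : X.pt n ω ≤ t + h := hω.2
      have h4 : X.Ttrunc v (n + 1) ω ≤ v := min_le_right _ _
      exact Set.Ico_subset_Ico h2.le (by linarith)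
    · rw [Set.indicator_of_notMem hω]
      have h1 : ∀ s, Φ n (ω, s) = 0 := fun s => Set.indicator_of_notMem (fun hs => hω hs.1) _
      simp [h1]
  -- The intervals for distinct `n` are disjoint, so at most one term survives, and its density is
  -- `tildeLam` at `s`.
  have hpoint : ∀ s ω, ∑' n : ℤ, Φ n (ω, s) ≤
      {ω | X.pt (K + 1) (X.θ t ω) ≤ h}.indicator
        (fun ω => ENNReal.ofReal (X.tildeLam P v s ω)) ω := by
    intro s ω
    have hidx : ∀ n, (ω, s) ∈ S n → X.nextIdx s ω = n + 1 := by
      intro n hn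
      rw [nextIdx_eq_iff, add_sub_cancel_right]
      refine ⟨hn.2.1, lt_of_lt_of_le hn.2.2 ?_⟩
      have : X.Ttrunc v (n + 1) ω ≤ X.pt (n + 1) ω - X.pt n ω := by
        refine (min_le_left _ _).trans ?_
        rw [T, add_sub_cancel_right]
      simp only
      linarith
    rw [tsum_eq_single (X.nextIdx s ω - 1)]
    · by_cases hn : (ω, s) ∈ S (X.nextIdx s ω - 1)
      · simp only [hΦ]
        rw [Set.indicator_of_mem hn, Set.indicator_of_mem]
        · simp only [hc, tildeLam, sub_add_cancel]
          exact le_rfl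
        · have h1 := (X.lt_pt_iff _ t ω).1 hn.1.1
          have h2 : X.pt (X.nextIdx s ω - 1) ω ≤ t + h := hn.1.2
          simp only [Set.mem_ofPred_eq, pt_θ]
          have h3 := (X.pt_strictMono ω).monotone
            (show (K : ℤ) + 1 + X.nextIdx t ω - 1 ≤ X.nextIdx s ω - 1 by omega)
          linarith
      · simp only [hΦ]
        rw [Set.indicator_of_notMem hn]
        exact zero_le
    · intro n hn
      refine Set.indicator_of_notMem (fun hn' => hn ?_) _
      rw [hidx n hn']
      ring
  refine hcount.trans ?_
  simp_rw [hterm]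
  have hswap : ∀ n, ∫⁻ ω, ∫⁻ s in Set.Ico t (t + h + v), Φ n (ω, s) ∂volume ∂P =
      ∫⁻ s in Set.Ico t (t + h + v), ∫⁻ ω, Φ n (ω, s) ∂P := fun n =>
    lintegral_lintegral_swap (hΦm n).aemeasurable
  simp_rw [hswap]
  rw [← lintegral_tsum fun n => (hΦm n).lintegral_prod_left'.aemeasurable]
  refine lintegral_mono fun s => ?_
  have hΦs : ∀ n, Measurable fun ω => Φ n (ω, s) := fun n =>
    (hΦm n).comp measurable_prodMk_right
  rw [← lintegral_tsum fun n => (hΦs n).aemeasurable, ← lintegral_indicator hDm]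
  exact lintegral_mono (hpoint s)

theorem lintegral_tildeLam_le (P : Measure Ω) {v : ℝ} {D : Set Ω} (hD : MeasurableSet D)
    (s : ℝ) {C : ℝ≥0∞} (hC : eLpNorm (D.indicator (X.tildeLam P v s)) 1 P ≤ C) :
    ∫⁻ ω in D, ENNReal.ofReal (X.tildeLam P v s ω) ∂P ≤ C := by
  refine le_trans ?_ hC
  rw [eLpNorm_one_eq_lintegral_enorm, ← lintegral_indicator hD]
  refine lintegral_mono fun ω => ?_
  by_cases hω : ω ∈ D
  · simp only [hω, Set.indicator_of_mem]
    exact Real.ofReal_le_enorm _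
  · simp [hω]

/-- Under uniform integrability, the expected numbers of points in windows of fixed length are
bounded. -/
theorem exists_tsum_palm_le (P : Measure Ω) [IsProbabilityMeasure P]
    (hUI : ∃ v : ℝ, 0 < v ∧
      UniformIntegrable (fun (t : ℝ≥0) (ω : Ω) => X.tildeLam P v t ω) 1 P) (h : ℝ) :
    ∃ C : ℝ≥0, ∀ t : ℝ, 0 ≤ t → ∑' j : ℕ, P {ω | X.pt (j + 1) (X.θ t ω) ≤ h} ≤ C := by
  obtain ⟨v, hv, -, -, C, hC⟩ := hUI
  refine ⟨C * (h + v).toNNReal, fun t ht => ?_⟩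
  have h1 := X.tsum_palm_le_lintegral_tildeLam P hv 0 t h
  simp only [Nat.cast_zero, zero_add, add_comm (1 : ℤ)] at h1
  refine h1.trans ?_
  have h2 : ∀ s ∈ Set.Ico t (t + h + v), ∫⁻ ω in {ω | X.pt 1 (X.θ t ω) ≤ h},
      ENNReal.ofReal (X.tildeLam P v s ω) ∂P ≤ C := by
    intro s hs
    refine X.lintegral_tildeLam_le P (X.measurableSet_pt_θ_le 1 t h) s ?_
    exact (eLpNorm_indicator_le _).trans (hC ⟨s, ht.trans hs.1⟩)
  refine (setLIntegral_mono measurable_const h2).trans ?_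
  rw [setLIntegral_const, Real.volume_Ico, show t + h + v - t = h + v by ring, ENNReal.coe_mul]
  rfl

/-- Under uniform integrability, the numbers of points in windows of fixed length are uniformly
integrable. -/
theorem exists_tsum_palm_tail_le (P : Measure Ω) [IsProbabilityMeasure P]
    (hUI : ∃ v : ℝ, 0 < v ∧
      UniformIntegrable (fun (t : ℝ≥0) (ω : Ω) => X.tildeLam P v t ω) 1 P) {h : ℝ} (hh : 0 < h)
    {ε : ℝ} (hε : 0 < ε) :
    ∃ K₀ : ℕ, ∀ K ≥ K₀, ∀ t : ℝ, 0 ≤ t →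
      ∑' j : ℕ, P {ω | X.pt (K + 1 + j) (X.θ t ω) ≤ h} ≤ ENNReal.ofReal ε := by
  obtain ⟨C, hC⟩ := X.exists_tsum_palm_le P hUI h
  obtain ⟨v, hv, -, hUI, -⟩ := hUI
  have hhv : 0 < h + v := by positivity
  obtain ⟨δ, hδ, hδε⟩ := hUI (div_pos hε hhv)
  obtain ⟨K₀, hK₀⟩ := exists_nat_gt (C / δ)
  refine ⟨K₀, fun K hK t ht => ?_⟩
  -- Markov's inequality: the first `K + 1` terms of the sum bounded by `C` each dominate this
  -- probability.
  have hmarkov : P {ω | X.pt (K + 1) (X.θ t ω) ≤ h} ≤ ENNReal.ofReal δ := by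
    have h1 : ((K + 1 : ℕ) : ℝ≥0∞) * P {ω | X.pt (K + 1) (X.θ t ω) ≤ h} ≤ C := by
      refine le_trans ?_ (hC t ht)
      refine le_trans ?_ (ENNReal.sum_le_tsum (Finset.range (K + 1)))
      rw [← nsmul_eq_mul]
      conv_lhs => rw [← Finset.card_range (K + 1)]
      refine Finset.card_nsmul_le_sum _ _ _ fun j hj => measure_mono fun ω hω => ?_
      have hj' : (j : ℤ) + 1 ≤ K + 1 := by
        have := Finset.mem_range.1 hj
        omega
      exact ((X.pt_strictMono _).monotone hj').trans hω
    have h2 : (C : ℝ) ≤ (K + 1 : ℕ) * δ := by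
      have h3 : (K₀ : ℝ) ≤ (K + 1 : ℕ) := by exact_mod_cast hK.trans (Nat.le_succ K)
      exact ((div_le_iff₀ hδ).1 hK₀.le).trans (by gcongr)
    have h3 : (C : ℝ≥0∞) ≤ ((K + 1 : ℕ) : ℝ≥0∞) * ENNReal.ofReal δ := by
      rw [← ENNReal.ofReal_natCast, ← ENNReal.ofReal_mul (by positivity), ← ENNReal.ofReal_coe_nnreal]
      exact ENNReal.ofReal_le_ofReal h2
    exact (ENNReal.mul_le_mul_iff_right (by simp) (by simp)).1 (h1.trans h3)
  refine (X.tsum_palm_le_lintegral_tildeLam P hv K t h).trans ?_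
  have hD := X.measurableSet_pt_θ_le (K + 1) t h
  have h2 : ∀ s ∈ Set.Ico t (t + h + v), ∫⁻ ω in {ω | X.pt (K + 1) (X.θ t ω) ≤ h},
      ENNReal.ofReal (X.tildeLam P v s ω) ∂P ≤ ENNReal.ofReal (ε / (h + v)) := fun s hs =>
    X.lintegral_tildeLam_le P hD s (hδε ⟨s, ht.trans hs.1⟩ _ hD hmarkov)
  refine (setLIntegral_mono measurable_const h2).trans ?_
  rw [setLIntegral_const, Real.volume_Ico, show t + h + v - t = h + v by ring,
    ← ENNReal.ofReal_mul (by positivity), div_mul_cancel₀ _ hhv.ne']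

end FlowPointProcess

/-! ### Linear growth from increments. -/

/-- A monotone function with convergent unit increments grows linearly. -/
theorem tendsto_div_of_tendsto_increment {M : ℝ → ℝ} {l : ℝ}
    (hM : MonotoneOn M (Set.Ici 0))
    (hinc : Tendsto (fun t => M (t + 1) - M t) atTop (𝓝 l)) :
    Tendsto (fun t => M t / t) atTop (𝓝 l) := by
  have h1 : Tendsto (fun n : ℕ => M ((n : ℝ) + 1) - M n) atTop (𝓝 l) :=
    hinc.comp tendsto_natCast_atTop_atTop
  have h2 := h1.cesaro
  have h3 : ∀ n : ℕ, ∑ i ∈ Finset.range n, (M ((i : ℝ) + 1) - M i) = M n - M 0 := fun n => by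
    have := Finset.sum_range_sub (fun i : ℕ => M i) n
    simpa using this
  have h4 : Tendsto (fun n : ℕ => M n / n) atTop (𝓝 l) := by
    have h5 : Tendsto (fun n : ℕ => M 0 / (n : ℝ)) atTop (𝓝 0) :=
      tendsto_const_div_atTop_nhds_zero_nat _
    have h6 := h2.add h5
    rw [add_zero] at h6
    refine h6.congr fun n => ?_
    rw [h3, inv_mul_eq_div, ← add_div, sub_add_cancel]
  have hfloor : Tendsto (fun t : ℝ => (⌊t⌋₊ : ℝ) / t) atTop (𝓝 1) := tendsto_nat_floor_div_atTop
  -- Monotonicity sandwiches `M t` between its values at `⌊t⌋₊` and `⌊t⌋₊ + 1`.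
  have hlow : Tendsto (fun t : ℝ => M ⌊t⌋₊ / t) atTop (𝓝 l) := by
    have h5 := (h4.comp (tendsto_nat_floor_atTop (α := ℝ))).mul hfloor
    rw [mul_one] at h5
    refine h5.congr' ?_
    filter_upwards [eventually_ge_atTop 1] with t ht
    have : (⌊t⌋₊ : ℝ) ≠ 0 := by exact_mod_cast (Nat.floor_pos.2 ht).ne'
    simp only [Function.comp_apply]
    field_simp
  have hupp : Tendsto (fun t : ℝ => M ((⌊t⌋₊ : ℝ) + 1) / t) atTop (𝓝 l) := by
    have h5 := (h1.comp (tendsto_nat_floor_atTop (α := ℝ))).mul tendsto_inv_atTop_zero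
    have h6 := hlow.add h5
    rw [mul_zero, add_zero] at h6
    refine h6.congr fun t => ?_
    simp only [Function.comp_apply]
    ring
  refine tendsto_of_tendsto_of_tendsto_of_le_of_le' hlow hupp ?_ ?_
  · filter_upwards [eventually_gt_atTop 0] with t ht
    exact div_le_div_of_nonneg_right
      (hM (Set.mem_Ici.2 (Nat.cast_nonneg _)) ht.le (Nat.floor_le ht.le)) ht.le
  · filter_upwards [eventually_gt_atTop 0] with t ht
    exact div_le_div_of_nonneg_right
      (hM ht.le (Set.mem_Ici.2 (by positivity)) (Nat.lt_floor_add_one t).le) ht.le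

/-! ### Counting points and Blackwell's theorem. -/

namespace FlowPointProcess

variable {Ω : Type*} [MeasurableSpace Ω] (X : FlowPointProcess Ω)

theorem N_eq_nextIdx {ω : Ω} (hω : X.pt 0 ω = 0) (t : ℝ) : X.N t ω = (X.nextIdx t ω).toNat := by
  have : {n : ℤ | X.pt n ω ∈ Set.Icc 0 t} = Set.Ico 0 (X.nextIdx t ω) := by
    ext n
    have h0 : 0 ≤ X.pt n ω ↔ 0 ≤ n := by
      rw [← hω]
      exact (X.pt_strictMono ω).le_iff_le
    simp only [Set.mem_ofPred_eq, Set.mem_Icc, h0, pt_le_iff, Set.mem_Ico]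
  rw [N, count, this, ← Finset.coe_Ico, Set.ncard_coe_finset, Int.card_Ico, sub_zero]

theorem aemeasurable_N (P : Measure Ω) (h0 : ∀ᵐ ω ∂P, X.pt 0 ω = 0) (t : ℝ) :
    AEMeasurable (X.N t) P :=
  ⟨fun ω => (X.nextIdx t ω).toNat, (measurable_of_countable Int.toNat).comp (X.measurable_nextIdx t),
    h0.mono fun _ hω => X.N_eq_nextIdx hω t⟩

/-- Writing a count as a sum of indicators of successive points reduces its mean to one-point
probabilities. -/
theorem N_add {ω : Ω} (hω : X.pt 0 ω = 0) {t h : ℝ} (ht : 0 ≤ t) (hh : 0 ≤ h) :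
    (X.N (t + h) ω : ℝ≥0∞) = X.N t ω +
      ∑' j : ℕ, {ω | X.pt (j + 1) (X.θ t ω) ≤ h}.indicator (1 : Ω → ℝ≥0∞) ω := by
  have h1 : X.nextIdx 0 ω ≤ X.nextIdx t ω := X.nextIdx_mono ω ht
  rw [nextIdx_zero] at h1
  have h2 : X.nextIdx t ω ≤ X.nextIdx (t + h) ω := X.nextIdx_mono ω (by linarith)
  set d := (X.nextIdx (t + h) ω - X.nextIdx t ω).toNat with hd
  have h3 : ∀ j : ℕ, {ω | X.pt (j + 1) (X.θ t ω) ≤ h}.indicator (1 : Ω → ℝ≥0∞) ω =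
      if j ∈ Finset.range d then 1 else 0 := by
    intro j
    have : X.pt (j + 1) (X.θ t ω) ≤ h ↔ j ∈ Finset.range d := by
      rw [pt_θ, sub_le_iff_le_add, add_comm h, pt_le_iff, Finset.mem_range]
      omega
    simp only [Set.indicator_apply, Set.mem_ofPred_eq, this, Pi.one_apply]
  rw [tsum_congr h3, tsum_eq_sum (s := Finset.range d) fun j hj => if_neg hj,
    Finset.sum_congr rfl fun j hj => if_pos hj]
  simp only [Finset.sum_const, Finset.card_range, nsmul_eq_mul, mul_one]
  rw [X.N_eq_nextIdx hω, X.N_eq_nextIdx hω]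
  norm_cast
  omega

theorem N_zero {ω : Ω} (hω : X.pt 0 ω = 0) : X.N 0 ω = 1 := by
  rw [X.N_eq_nextIdx hω, nextIdx_zero]
  rfl

theorem lintegral_N_add (P : Measure Ω) (h0 : ∀ᵐ ω ∂P, X.pt 0 ω = 0) {t h : ℝ}
    (ht : 0 ≤ t) (hh : 0 ≤ h) :
    ∫⁻ ω, (X.N (t + h) ω : ℝ≥0∞) ∂P =
      ∫⁻ ω, (X.N t ω : ℝ≥0∞) ∂P + ∑' j : ℕ, P {ω | X.pt (j + 1) (X.θ t ω) ≤ h} := by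
  have hm : ∀ j : ℕ,
      Measurable ({ω | X.pt (j + 1) (X.θ t ω) ≤ h}.indicator (1 : Ω → ℝ≥0∞)) := fun j =>
    measurable_one.indicator (X.measurableSet_pt_θ_le _ t h)
  rw [lintegral_congr_ae (h0.mono fun ω hω => X.N_add hω ht hh),
    lintegral_add_right _ (Measurable.tsum hm), lintegral_tsum fun j => (hm j).aemeasurable]
  simp_rw [lintegral_indicator_one (X.measurableSet_pt_θ_le _ t h)]

/-- The intensity of the stationary law. -/
theorem tsum_stat_pt_le (P : Measure Ω) [IsProbabilityMeasure P] (h0 : ∀ᵐ ω ∂P, X.pt 0 ω = 0)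
    (hPalm : ∀ n : ℤ, MeasurePreserving (fun ω => X.θ (X.pt n ω) ω) P P) (h : ℝ) :
    ∑' j : ℕ, X.stat P {ω | X.pt (j + 1) ω ≤ h} =
      ENNReal.ofReal (1 / ∫ ω, X.T 1 ω ∂P) * ENNReal.ofReal h := by
  have h1 := X.lintegral_stat_tsum_pt P h0 hPalm (f := 1) measurable_one h
  simp only [Pi.one_apply, mul_one, lintegral_one, measure_univ] at h1
  simp_rw [← h1, ← lintegral_indicator_one (X.measurableSet_pt_le _ h)]
  rw [← lintegral_tsum fun j =>
    (measurable_one.indicator (X.measurableSet_pt_le _ h)).aemeasurable]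
  refine lintegral_congr fun ω => ?_
  have hinj : Function.Injective fun j : ℕ => (j : ℤ) + 1 := fun a b hab => by
    simpa using hab
  rw [← hinj.tsum_eq]
  · refine tsum_congr fun j => ?_
    have hj : 0 < X.pt (j + 1) ω :=
      (X.pt_one_pos ω).trans_le ((X.pt_strictMono ω).monotone (by omega))
    simp only [Set.indicator_apply, Set.mem_ofPred_eq, Set.mem_Ioc, hj, true_and, Pi.one_apply]
  · intro n hn
    have hn' : X.pt n ω ∈ Set.Ioc 0 h := by
      by_contra hn'
      exact hn (Set.indicator_of_notMem hn' _)
    have hn1 : 0 < n := by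
      by_contra! hle
      have := (X.pt_strictMono ω).monotone hle
      linarith [hn'.1, X.pt_zero_nonpos ω]
    exact ⟨(n - 1).toNat, by simp only; omega⟩

/-- Blackwell's theorem for the expected number of points in a window. -/
theorem tendsto_tsum_palm (P : Measure Ω) [IsProbabilityMeasure P]
    (h0 : ∀ᵐ ω ∂P, X.pt 0 ω = 0) (hT : Integrable (X.T 1) P)
    (hPalm : ∀ n : ℤ, MeasurePreserving (fun ω => X.θ (X.pt n ω) ω) P P)
    (hUI : ∃ v : ℝ, 0 < v ∧
      UniformIntegrable (fun (t : ℝ≥0) (ω : Ω) => X.tildeLam P v t ω) 1 P)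
    (hMix : ∀ A : Set Ω, MeasurableSet A → ∀ u : ℝ, 0 ≤ u →
      Tendsto (fun t : ℝ => X.stat P ({ω | X.θ t ω ∈ A} ∩ {ω | X.pt 1 ω ≤ u})) atTop
        (𝓝 (X.stat P A * X.stat P {ω | X.pt 1 ω ≤ u})))
    {h : ℝ} (hh : 0 < h) :
    Tendsto (fun t : ℝ => (∑' j : ℕ, P {ω | X.pt (j + 1) (X.θ t ω) ≤ h}).toReal) atTop
      (𝓝 (1 / (∫ ω, X.T 1 ω ∂P) * h)) := by
  have := X.isProbabilityMeasure_stat P hT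
  have hE := X.integral_T_pos P hT
  have hL : Tendsto (fun K : ℕ => ∑ j ∈ Finset.range K, (X.stat P).real {ω | X.pt (j + 1) ω ≤ h})
      atTop (𝓝 (1 / (∫ ω, X.T 1 ω ∂P) * h)) := by
    have h1 := X.tsum_stat_pt_le P h0 hPalm h
    have h2 := ENNReal.hasSum_toReal (f := fun j : ℕ => X.stat P {ω | X.pt (j + 1) ω ≤ h})
      (by rw [h1]; finiteness)
    rw [← ENNReal.tsum_toReal_eq fun j => by finiteness, h1, ENNReal.toReal_mul,
      ENNReal.toReal_ofReal (by positivity), ENNReal.toReal_ofReal hh.le] at h2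
    exact h2.tendsto_sum_nat
  -- The limits in `K` and `t` may be exchanged because the tails are small uniformly in `t ≥ 0`.
  have hunif : TendstoUniformlyOnFilter
      (fun (K : ℕ) (t : ℝ) => ∑ j ∈ Finset.range K, P.real {ω | X.pt (j + 1) (X.θ t ω) ≤ h})
      (fun t : ℝ => (∑' j : ℕ, P {ω | X.pt (j + 1) (X.θ t ω) ≤ h}).toReal) atTop atTop := by
    refine TendstoUniformlyOnFilter.mono_right ?_ (le_principal_iff.2 (Ici_mem_atTop (0 : ℝ)))
    rw [← tendstoUniformlyOn_iff_tendstoUniformlyOnFilter, Metric.tendstoUniformlyOn_iff]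
    intro ε hε
    obtain ⟨K₀, hK₀⟩ := X.exists_tsum_palm_tail_le P hUI hh (half_pos hε)
    filter_upwards [eventually_ge_atTop K₀] with K hK t ht
    have h1 := hK₀ K hK t ht
    have h2 := Summable.sum_add_tsum_nat_add' (k := K)
      (f := fun j : ℕ => P {ω | X.pt (j + 1) (X.θ t ω) ≤ h}) ENNReal.summable
    have h3 : ∑' j : ℕ, P {ω | X.pt ((j + K : ℕ) + 1) (X.θ t ω) ≤ h} =
        ∑' j : ℕ, P {ω | X.pt (K + 1 + j) (X.θ t ω) ≤ h} := by
      refine tsum_congr fun j => ?_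
      rw [show (((j + K : ℕ) : ℤ) + 1) = K + 1 + j by push_cast; ring]
    rw [h3] at h2
    rw [← h2, ENNReal.toReal_add (ENNReal.sum_ne_top.2 fun j _ => measure_ne_top _ _)
        (ne_top_of_le_ne_top (by finiteness) h1),
      ENNReal.toReal_sum fun j _ => by finiteness]
    simp only [← measureReal_def]
    rw [Real.dist_eq, add_sub_cancel_left, abs_of_nonneg ENNReal.toReal_nonneg]
    refine (ENNReal.toReal_mono (by finiteness) h1).trans_lt ?_
    rw [ENNReal.toReal_ofReal (half_pos hε).le]
    exact half_lt_self hε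
  refine hunif.tendsto_of_eventually_tendsto (Eventually.of_forall fun K => ?_) hL
  exact tendsto_finsetSum _ fun j _ => X.tendsto_palm_pt_θ_le P h0 hT hPalm hMix (j + 1) h

/-! ### The intensity formula. -/

/-- Along a cycle `condMean` is constant, since the flow returns to the origin; only `R(0) = T_1 -
s` varies, and it is at most `v` on a length `T_1^{(v)}`. -/
theorem lintegral_stat_indicator_R_condMean (P : Measure Ω) [IsProbabilityMeasure P]
    (h0 : ∀ᵐ ω ∂P, X.pt 0 ω = 0) (v : ℝ) {φ : ℝ → ℝ≥0∞} (hφ : Measurable φ) :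
    ∫⁻ ω, {ω | X.R 0 ω ≤ v}.indicator (fun ω => φ (X.condMean P v ω)) ω ∂(X.stat P) =
      ENNReal.ofReal (1 / ∫ ω, X.T 1 ω ∂P) * ∫⁻ ω, ENNReal.ofReal (X.Ttrunc v 1 ω) *
        φ ((P[X.Ttrunc v 1 | X.Fleft 0]) ω) ∂P := by
  have hg : Measurable (P[X.Ttrunc v 1 | X.Fleft 0]) :=
    (stronglyMeasurable_condExp.mono (X.Fleft_le 0)).measurable
  have hcm : Measurable (X.condMean P v) := hg.comp (X.measurable_θ_pt 0)
  have hm : Measurable ({ω | X.R 0 ω ≤ v}.indicator fun ω => φ (X.condMean P v ω)) :=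
    (hφ.comp hcm).indicator (measurableSet_le (X.measurable_R 0) measurable_const)
  rw [X.lintegral_stat P hm]
  congr 1
  refine lintegral_congr_ae (h0.mono fun ω hω => ?_)
  simp only [Ttrunc]
  have hm' : Measurable fun s => (Set.Iic v).indicator (1 : ℝ → ℝ≥0∞) (X.T 1 ω - s) :=
    (measurable_one.indicator measurableSet_Iic).comp (measurable_const.sub measurable_id)
  rw [← setLIntegral_Ico_sub_le, ← lintegral_mul_const _ hm']
  refine setLIntegral_congr_fun measurableSet_Ico fun s hs => ?_
  have h1 : X.condMean P v (X.θ s ω) = (P[X.Ttrunc v 1 | X.Fleft 0]) ω := by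
    rw [condMean, θ_pt_θ, X.nextIdx_of_mem hω hs, zero_add, sub_self, hω, X.θ_zero]
  have h2 : X.R 0 (X.θ s ω) = X.T 1 ω - s := by
    rw [R, nextIdx_zero, X.pt_one_θ_of_mem hω hs, sub_zero]
  simp only [Set.indicator_apply, Set.mem_ofPred_eq, h1, h2, Set.mem_Iic, Pi.one_apply]
  split_ifs <;> simp

/-- The intensity as a stationary mean of reciprocal conditional means. -/
theorem integral_stat_indicator_R_condMean (P : Measure Ω) [IsProbabilityMeasure P]
    (h0 : ∀ᵐ ω ∂P, X.pt 0 ω = 0) {v : ℝ} (hv : 0 < v) :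
    Integrable ({ω | X.R 0 ω ≤ v}.indicator fun ω => 1 / X.condMean P v ω) (X.stat P) ∧
      1 / ∫ ω, X.T 1 ω ∂P =
        ∫ ω, {ω | X.R 0 ω ≤ v}.indicator (fun ω => 1 / X.condMean P v ω) ω ∂(X.stat P) := by
  have hg : Measurable (P[X.Ttrunc v 1 | X.Fleft 0]) :=
    (stronglyMeasurable_condExp.mono (X.Fleft_le 0)).measurable
  have hcm : Measurable (X.condMean P v) := hg.comp (X.measurable_θ_pt 0)
  have hFm : Measurable ({ω | X.R 0 ω ≤ v}.indicator fun ω => 1 / X.condMean P v ω) :=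
    (hcm.const_div 1).indicator (measurableSet_le (X.measurable_R 0) measurable_const)
  have hl : 0 ≤ 1 / ∫ ω, X.T 1 ω ∂P :=
    one_div_nonneg.2 (integral_nonneg fun ω => (X.T_pos 1 ω).le)
  have hpos := ae_condExp_pos (X.Fleft_le 0) (X.integrable_Ttrunc P hv 1) (X.Ttrunc_pos hv 1)
  have hone : ∫⁻ ω, ENNReal.ofReal (X.Ttrunc v 1 ω) *
      ENNReal.ofReal (1 / (P[X.Ttrunc v 1 | X.Fleft 0]) ω) ∂P = 1 := by
    have := setLIntegral_mul_inv_condExp (X.Fleft_le 0) (X.integrable_Ttrunc P hv 1)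
      (X.measurable_Ttrunc v 1) (X.Ttrunc_pos hv 1) MeasurableSet.univ
    rwa [Measure.restrict_univ, measure_univ] at this
  -- One identity serves the norm and the positive and negative parts; `ψ 0 = 0` is needed where the
  -- indicator vanishes.
  have key : ∀ ψ : ℝ → ℝ≥0∞, Measurable ψ → ψ 0 = 0 →
      ∫⁻ ω, ψ ({ω | X.R 0 ω ≤ v}.indicator (fun ω => 1 / X.condMean P v ω) ω) ∂(X.stat P) =
        ENNReal.ofReal (1 / ∫ ω, X.T 1 ω ∂P) * ∫⁻ ω, ENNReal.ofReal (X.Ttrunc v 1 ω) *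
          ψ (1 / (P[X.Ttrunc v 1 | X.Fleft 0]) ω) ∂P := by
    intro ψ hψ hψ0
    rw [← X.lintegral_stat_indicator_R_condMean P h0 v (φ := fun x => ψ (1 / x))
      (hψ.comp (measurable_id.const_div 1))]
    refine lintegral_congr fun ω => ?_
    simp only [Set.indicator_apply]
    split_ifs <;> simp [hψ0]
  have hint : Integrable ({ω | X.R 0 ω ≤ v}.indicator fun ω => 1 / X.condMean P v ω)
      (X.stat P) := by
    refine ⟨hFm.aestronglyMeasurable, ?_⟩
    rw [HasFiniteIntegral, key (fun x => ‖x‖ₑ) measurable_enorm enorm_zero]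
    refine ENNReal.mul_lt_top ENNReal.ofReal_lt_top ?_
    rw [lintegral_congr_ae (g := fun ω => ENNReal.ofReal (X.Ttrunc v 1 ω) *
      ENNReal.ofReal (1 / (P[X.Ttrunc v 1 | X.Fleft 0]) ω)), hone]
    · exact ENNReal.one_lt_top
    · filter_upwards [hpos] with ω hω
      rw [Real.enorm_eq_ofReal (one_div_nonneg.2 hω.le)]
  refine ⟨hint, ?_⟩
  rw [integral_eq_lintegral_pos_part_sub_lintegral_neg_part hint,
    key (fun x => ENNReal.ofReal x) ENNReal.measurable_ofReal ENNReal.ofReal_zero,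
    key (fun x => ENNReal.ofReal (-x)) (ENNReal.measurable_ofReal.comp measurable_neg) (by simp),
    hone]
  have hzero : ∫⁻ ω, ENNReal.ofReal (X.Ttrunc v 1 ω) *
      ENNReal.ofReal (-(1 / (P[X.Ttrunc v 1 | X.Fleft 0]) ω)) ∂P = 0 := by
    rw [lintegral_congr_ae (g := fun _ => 0), lintegral_zero]
    filter_upwards [hpos] with ω hω
    rw [ENNReal.ofReal_of_nonpos (neg_nonpos.2 (one_div_nonneg.2 hω.le)), mul_zero]
  rw [hzero, mul_zero, mul_one, ENNReal.toReal_ofReal hl, ENNReal.toReal_zero, sub_zero]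

end FlowPointProcess

/-! ### Assembly of the main theorem. -/

theorem corollary5p2 {Ω : Type*} [MeasurableSpace Ω] (X : FlowPointProcess Ω)
    (P : Measure Ω) [IsProbabilityMeasure P]
    -- there is a point at the origin
    (hA1 : ∀ᵐ ω ∂P, X.pt 0 ω = 0)
    -- finite means
    (hA2 : ∀ n : ℤ, 1 ≤ n → Integrable (X.T n) P)
    -- invariance of the Palm distribution under shifts to the points
    (hPalm : ∀ n : ℤ, MeasurePreserving (fun ω => X.θ (X.pt n ω) ω) P P)
    -- the interarrival times are a stationary and ergodic sequence
    (hErg : Ergodic (fun (x : ℤ → ℝ) (n : ℤ) => x (n + 1))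
      (Measure.map (fun ω (n : ℤ) => X.T n ω) P))
    -- uniform integrability, for some truncation level
    (hUI : ∃ v : ℝ, 0 < v ∧
      UniformIntegrable (fun (t : ℝ≥0) (ω : Ω) => X.tildeLam P v t ω) 1 P)
    -- mixing under the stationary law
    (hMix : ∀ A : Set Ω, MeasurableSet A → ∀ u : ℝ, 0 ≤ u →
      Tendsto (fun t : ℝ => X.stat P ({ω | X.θ t ω ∈ A} ∩ {ω | X.pt 1 ω ≤ u})) atTop
        (𝓝 (X.stat P A * X.stat P {ω | X.pt 1 ω ≤ u}))) :
    ∃ lam : ℝ, 0 < lam ∧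
      (∀ t : ℝ, 0 ≤ t → Integrable (fun ω => (X.N t ω : ℝ)) P) ∧
      Tendsto (fun t : ℝ => (∫ ω, (X.N t ω : ℝ) ∂P) / t) atTop (𝓝 lam) ∧
      (∀ h : ℝ, 0 < h →
        Tendsto (fun t : ℝ => (∫ ω, (X.N (t + h) ω : ℝ) ∂P) - ∫ ω, (X.N t ω : ℝ) ∂P) atTop
          (𝓝 (lam * h))) ∧
      lam = 1 / ∫ ω, X.T 1 ω ∂P ∧
      ∀ v : ℝ, 0 < v →
        Integrable ({ω | X.R 0 ω ≤ v}.indicator fun ω => 1 / X.condMean P v ω) (X.stat P) ∧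
        lam = ∫ ω, {ω | X.R 0 ω ≤ v}.indicator (fun ω => 1 / X.condMean P v ω) ω ∂(X.stat P) := by
  have hT := hA2 1 le_rfl
  have hfin : ∀ t : ℝ, 0 ≤ t → ∫⁻ ω, (X.N t ω : ℝ≥0∞) ∂P ≠ ∞ := by
    intro t ht
    obtain ⟨C, hC⟩ := X.exists_tsum_palm_le P hUI t
    have h1 := X.lintegral_N_add P hA1 le_rfl ht
    -- The point at the origin belongs to `[0, t]`, hence the extra summand one.
    rw [zero_add, lintegral_congr_ae (hA1.mono fun ω hω =>
      show (X.N 0 ω : ℝ≥0∞) = 1 by rw [X.N_zero hω, Nat.cast_one]), lintegral_one,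
      measure_univ] at h1
    rw [h1]
    exact ENNReal.add_ne_top.2 ⟨ENNReal.one_ne_top, ne_top_of_le_ne_top ENNReal.coe_ne_top
      (hC 0 le_rfl)⟩
  have hmeas : ∀ t, AEStronglyMeasurable (fun ω => (X.N t ω : ℝ)) P := fun t =>
    ((measurable_of_countable fun n : ℕ => (n : ℝ)).comp_aemeasurable
      (X.aemeasurable_N P hA1 t)).aestronglyMeasurable
  have henorm : ∀ t ω, ‖(X.N t ω : ℝ)‖ₑ = (X.N t ω : ℝ≥0∞) := fun t ω => by
    rw [Real.enorm_eq_ofReal (Nat.cast_nonneg _), ENNReal.ofReal_natCast]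
  have hint : ∀ t : ℝ, 0 ≤ t → Integrable (fun ω => (X.N t ω : ℝ)) P := by
    intro t ht
    refine ⟨hmeas t, ?_⟩
    simp only [HasFiniteIntegral, henorm]
    exact (hfin t ht).lt_top
  have hval : ∀ t, ∫ ω, (X.N t ω : ℝ) ∂P = (∫⁻ ω, (X.N t ω : ℝ≥0∞) ∂P).toReal := by
    intro t
    rw [integral_eq_lintegral_of_nonneg_ae (ae_of_all _ fun ω => Nat.cast_nonneg _) (hmeas t)]
    simp only [ENNReal.ofReal_natCast]
  have hdiff : ∀ t h : ℝ, 0 ≤ t → 0 ≤ h → (∫ ω, (X.N (t + h) ω : ℝ) ∂P) - ∫ ω, (X.N t ω : ℝ) ∂P =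
      (∑' j : ℕ, P {ω | X.pt (j + 1) (X.θ t ω) ≤ h}).toReal := by
    intro t h ht hh
    obtain ⟨C, hC⟩ := X.exists_tsum_palm_le P hUI h
    rw [hval, hval, X.lintegral_N_add P hA1 ht hh, ENNReal.toReal_add (hfin t ht)
      (ne_top_of_le_ne_top ENNReal.coe_ne_top (hC t ht)), add_sub_cancel_left]
  have hblack : ∀ h : ℝ, 0 < h →
      Tendsto (fun t : ℝ => (∫ ω, (X.N (t + h) ω : ℝ) ∂P) - ∫ ω, (X.N t ω : ℝ) ∂P) atTop
        (𝓝 (1 / (∫ ω, X.T 1 ω ∂P) * h)) := by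
    intro h hh
    refine (X.tendsto_tsum_palm P hA1 hT hPalm hUI hMix hh).congr' ?_
    filter_upwards [eventually_ge_atTop 0] with t ht
    exact (hdiff t h ht hh.le).symm
  refine ⟨1 / ∫ ω, X.T 1 ω ∂P, one_div_pos.2 (X.integral_T_pos P hT), hint, ?_, hblack, rfl,
    fun v hv => X.integral_stat_indicator_R_condMean P hA1 hv⟩
  refine tendsto_div_of_tendsto_increment (M := fun t => ∫ ω, (X.N t ω : ℝ) ∂P) ?_
    (by simpa using hblack 1 one_pos)
  intro s hs t _ hst
  have := hdiff s (t - s) hs (sub_nonneg.2 hst)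
  rw [add_sub_cancel] at this
  have h2 : 0 ≤ (∫ ω, (X.N t ω : ℝ) ∂P) - ∫ ω, (X.N s ω : ℝ) ∂P :=
    this ▸ ENNReal.toReal_nonneg
  simpa using h2
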